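/- **Setting.** For $0<a,b<1$ let $P=P_{(a,b)}$ be the convex quadrilateral with vertices $A=(0,1)$, $B=(a,1)$, $C=(1,b)$, $D=(0,0)$, and let $0<\lambda<1$. Call $x\in\mathbb{R}^2\setminus P$ regular if there is exactly one vertex $v$ of $P$ such that $P$ lies on the left of the ray from $x$ through $v$ (this excludes only the rays that extend the sides of $P$). For regular $x$ put $Tx=v+\lambda(v-x)$ (outer billiards with contraction). Let $X$ be the set of points all of whose iterates $x,Tx,T^2x,\dots$ are regular. A point $x\in X$ is *asymptotic* to a set $K$ if $\operatorname{dist}(T^nx,K)\to0$ and the $\omega$-limit set of $x$ is $K$. A *(possibly degenerate) periodic orbit* is a finite cyclic sequence $w_1,\dots,w_n$ in which each $(w_i,w_{i+1})$ lies in the closure of the graph of $T$ (so $w_{i+1}=Tw_i$ where $T$ is continuous, and $w_{i+1}$ is a limit of values $Tx$, with $x$ regular and $x\to w_i$, in general). A *Cantor set* is a nonempty, compact, perfect, totally disconnected set. Put $l=\lambda^{-1}+(1-a)\lambda^{-2}$ and, for $\varepsilon>0$, $R_1=[-l+\varepsilon,0]\times[1,1+\varepsilon^2]$ and $R_2=[-l+\varepsilon,0]\times[1-\varepsilon^2,1]$.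 The attractor $K_{(a,b)}$ is the (necessarily unique) set that is a periodic orbit or a Cantor set and has the property that, for all sufficiently small $\varepsilon>0$, $X\cap(R_1\cup R_2)$ is nonempty and all its points are asymptotic to $K_{(a,b)}$. **Theorem.** Let $b=0.4$ and $\lambda=0.6$. For every $a$ with $0.4\le a\le 0.5$ the attractor $K_{(a,b)}$ exists, and every point of $X$ (that is, every point of the plane outside $P$ whose forward orbit is defined for all times) is asymptotic to $K_{(a,b)}$. In particular, there are values $a\in[0.4,0.5]$ for which $K_{(a,b)}$ is a Cantor set, so that the whole domain $X$ is asymptotic to a single Cantor set. -/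

import Mathlib

open Set Filter Topology

/-- The cross product of two plane vectors; it is nonnegative iff `v` lies (weakly) to the left of
the direction `u`. -/
def cross (u v : ℝ × ℝ) : ℝ := u.1 * v.2 - u.2 * v.1

/-- `v` is a vertex (an element of `V`) such that the polygon `convexHull ℝ V` lies on the left of
the ray starting from `x` and passing through `v`. -/
def IsLeftTangentVertex (V : Set (ℝ × ℝ)) (x v : ℝ × ℝ) : Prop :=
  v ∈ V ∧ ∀ w ∈ convexHull ℝ V, 0 ≤ cross (v - x) (w - x)

/-- The points outside the polygon `convexHull ℝ V` at which the map is well defined, that is,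
the complement of the polygon and of the singular rays extending its sides. -/
def regularPoints (V : Set (ℝ × ℝ)) : Set (ℝ × ℝ) :=
  {x | x ∉ convexHull ℝ V ∧ ∃! v, IsLeftTangentVertex V x v}

open Classical in
/-- Outer billiards with contraction `lam` outside `convexHull ℝ V`: the point `x` goes to the
point `y` of the ray from `x` through the tangent vertex `v`, beyond `v`, with
`|xv| : |vy| = 1 : lam`.  (The value at a point that is not regular is irrelevant.) -/
noncomputable def outerBilliard (V : Set (ℝ × ℝ)) (lam : ℝ) (x : ℝ × ℝ) : ℝ × ℝ :=
  if h : x ∈ regularPoints V then h.2.choose + lam • (h.2.choose - x) else x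

/-- The set `X` of the points whose whole forward orbit is well defined. -/
def fullyRegular (V : Set (ℝ × ℝ)) (lam : ℝ) : Set (ℝ × ℝ) :=
  {x | ∀ n : ℕ, (outerBilliard V lam)^[n] x ∈ regularPoints V}

/-- The `ω`-limit set of the point `x`. -/
def omegaSet (V : Set (ℝ × ℝ)) (lam : ℝ) (x : ℝ × ℝ) : Set (ℝ × ℝ) :=
  omegaLimit atTop (fun (n : ℕ) (p : ℝ × ℝ) => (outerBilliard V lam)^[n] p) {x}

/-- The orbit of `x` is asymptotic to `K`: it converges to `K`, and it accumulates at every point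
of `K` and nowhere else. -/
def IsAsymptoticTo (V : Set (ℝ × ℝ)) (lam : ℝ) (x : ℝ × ℝ) (K : Set (ℝ × ℝ)) : Prop :=
  Tendsto (fun n : ℕ => Metric.infDist ((outerBilliard V lam)^[n] x) K) atTop (𝓝 0) ∧
    omegaSet V lam x = K

/-- A Cantor set: nonempty, compact, without isolated points, totally disconnected. -/
def IsCantorSet (K : Set (ℝ × ℝ)) : Prop :=
  K.Nonempty ∧ IsCompact K ∧ Perfect K ∧ IsTotallyDisconnected K

/-- `K` is the set of points of a (possibly degenerate) periodic orbit `w`: the successor of a point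
is its image under the map or, at a point where the map is discontinuous or not defined,
a limit of the images of regular points that converge to it. -/
def IsPeriodicOrbit (V : Set (ℝ × ℝ)) (lam : ℝ) (K : Set (ℝ × ℝ)) : Prop :=
  ∃ (n : ℕ) (w : ℕ → ℝ × ℝ), 0 < n ∧ (∀ i, w (i + n) = w i) ∧ range w = K ∧
    ∀ i, (w i, w (i + 1)) ∈
      closure {q : (ℝ × ℝ) × (ℝ × ℝ) | q.1 ∈ regularPoints V ∧ q.2 = outerBilliard V lam q.1}

/-- The vertices `A, B, C, D` of the quadrilateral `(a, b)`. -/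
def quadVertices (a b : ℝ) : Set (ℝ × ℝ) := {(0, 1), (a, 1), (1, b), (0, 0)}

/-- The length `l` of the segment from `E = (-l, 1)` to `A = (0, 1)`.  Here `E` is the intersection of
the line `AB` with the line through `D` and the point `G` of the line `BC` beyond `C` such that
`|BC| : |CG| = lam : 1`. -/
noncomputable def segLength (a lam : ℝ) : ℝ := 1 / lam + (1 - a) / lam ^ 2

/-- The closed rectangle `R₁` above the segment `EA`, of thickness `ε ^ 2`. -/
def rectUpper (a lam ε : ℝ) : Set (ℝ × ℝ) :=
  Icc (-segLength a lam + ε) 0 ×ˢ Icc 1 (1 + ε ^ 2)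

/-- The closed rectangle `R₂`, the reflection of `R₁` in the line `EA`. -/
def rectLower (a lam ε : ℝ) : Set (ℝ × ℝ) :=
  Icc (-segLength a lam + ε) 0 ×ˢ Icc (1 - ε ^ 2) 1

/-- `K` is the attractor `K_(a,b)` of the quadrilateral `(a, b)` with contraction `lam`:
a periodic orbit or a Cantor set to which, for all sufficiently small `ε`, every point of
`X ∩ (R₁ ∪ R₂)` is asymptotic.  As there are such points and `K` is their `ω`-limit set,
`K` is unique. -/
def IsRectAttractor (a b lam : ℝ) (K : Set (ℝ × ℝ)) : Prop :=
  (IsPeriodicOrbit (quadVertices a b) lam K ∨ IsCantorSet K) ∧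
    ∃ ε₀ > 0, ∀ ε : ℝ, 0 < ε → ε < ε₀ →
      (fullyRegular (quadVertices a b) lam ∩
        (rectUpper a lam ε ∪ rectLower a lam ε)).Nonempty ∧
      ∀ x ∈ fullyRegular (quadVertices a b) lam ∩ (rectUpper a lam ε ∪ rectLower a lam ε),
        IsAsymptoticTo (quadVertices a b) lam x K

/-! The dynamics reduces to an interval map with a single jump. The billiard map contracts by 0.6 on
each of the four domains of tangency, a box absorbs every orbit, and inside the box the tangent
vertices change only by A→D, D→C, C→A or B, B→A or D. Hence heights tend to -0.6 in the domain of C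
and to 1 in the others (`height_bound`), and every orbit reaches the domain of B
(`exists_iterate_mem_quadSection`), which serves as a section.

With c = 8a/3, the return to the section depends only on the side of c on which the first coordinate
x lies. On the left the vertices are B, A, D, C and x goes to 1.6 + 0.6^4 (x - c); on the right they
are B, D, C, A, D, C and x goes to 1.2544 + 0.6^6 (x - c). If c ≤ 1.2544, the right branch captures
every orbit and the attractor is periodic. Otherwise c is interior to [1.2544, 1.6], and inducing on
smaller intervals around c, as in Rauzy induction, reproduces maps of the same form (`induce_right`,
`induce_left`).

If the induction stops, a composition of the two branches maps the left part into itself, and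
contraction yields a periodic orbit (`exists_periodic_limit`). If it never stops, the intervals
shrink to c, and orbits are late concatenations of two excursions that start in arbitrarily narrow
blocks. This forces a common limit set that is perfect and has a null projection, hence is a Cantor
set (`isCantorSet_orbitLimit`). Nested parameter intervals give a value of c for which the induction
never stops (`exists_alternating`). The set X has points in the required rectangles because only
countably many x ever hit c. -/

/-! ### Limit sets of orbits. -/

/-- The `ω`-limit set of the orbit of `x` under iteration of `T`. -/
def orbitLimit (T : ℝ × ℝ → ℝ × ℝ) (x : ℝ × ℝ) : Set (ℝ × ℝ) :=
  omegaLimit atTop (fun (n : ℕ) (p : ℝ × ℝ) => T^[n] p) {x}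

lemma mem_orbitLimit {T : ℝ × ℝ → ℝ × ℝ} {x z : ℝ × ℝ} :
    z ∈ orbitLimit T x ↔ ∀ ε > 0, ∀ N : ℕ, ∃ n ≥ N, dist (T^[n] x) z < ε := by
  unfold orbitLimit
  rw [mem_omegaLimit_singleton_iff_mapClusterPt, mapClusterPt_iff_frequently]
  constructor
  · intro h ε hε N
    exact (frequently_atTop.1 (h _ (Metric.ball_mem_nhds z hε))) N
  · intro h s hs
    obtain ⟨ε, hε, hs⟩ := Metric.mem_nhds_iff.1 hs
    refine frequently_atTop.2 fun N => ?_
    obtain ⟨n, hn, hd⟩ := h ε hε N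
    exact ⟨n, hn, hs hd⟩

lemma orbitLimit_iterate (T : ℝ × ℝ → ℝ × ℝ) (x : ℝ × ℝ) (m : ℕ) :
    orbitLimit T (T^[m] x) = orbitLimit T x := by
  ext z
  simp only [mem_orbitLimit, ← Function.iterate_add_apply]
  constructor
  · intro h ε hε N
    obtain ⟨n, hn, hd⟩ := h ε hε N
    exact ⟨n + m, by omega, hd⟩
  · intro h ε hε N
    obtain ⟨n, hn, hd⟩ := h ε hε (N + m)
    exact ⟨n - m, by omega, by rwa [Nat.sub_add_cancel (by omega)]⟩

lemma orbitLimit_subset_of_eventually_mem {T : ℝ × ℝ → ℝ × ℝ} {x : ℝ × ℝ} {C : Set (ℝ × ℝ)}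
    (hC : IsClosed C) (N : ℕ) (h : ∀ n ≥ N, T^[n] x ∈ C) : orbitLimit T x ⊆ C := by
  intro z hz
  rw [← hC.closure_eq, Metric.mem_closure_iff]
  intro ε hε
  obtain ⟨n, hn, hd⟩ := mem_orbitLimit.1 hz ε hε N
  exact ⟨_, h n hn, by rwa [dist_comm]⟩

lemma isClosed_orbitLimit (T : ℝ × ℝ → ℝ × ℝ) (x : ℝ × ℝ) : IsClosed (orbitLimit T x) :=
  isClosed_omegaLimit _ _ _

lemma isCompact_orbitLimit {T : ℝ × ℝ → ℝ × ℝ} {x : ℝ × ℝ} {C : Set (ℝ × ℝ)}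
    (hC : IsCompact C) (h : ∀ n, T^[n] x ∈ C) : IsCompact (orbitLimit T x) :=
  hC.of_isClosed_subset (isClosed_orbitLimit T x)
    (orbitLimit_subset_of_eventually_mem hC.isClosed 0 fun n _ => h n)

lemma orbitLimit_nonempty {T : ℝ × ℝ → ℝ × ℝ} {x : ℝ × ℝ} {C : Set (ℝ × ℝ)}
    (hC : IsCompact C) (h : ∀ n, T^[n] x ∈ C) : (orbitLimit T x).Nonempty := by
  obtain ⟨z, -, hz⟩ := hC.exists_mapClusterPt (f := atTop) (u := fun n : ℕ => T^[n] x)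
    (tendsto_principal.2 (Eventually.of_forall h))
  exact ⟨z, (mem_omegaLimit_singleton_iff_mapClusterPt _ _ _ _).2 hz⟩

lemma tendsto_infDist_orbitLimit {T : ℝ × ℝ → ℝ × ℝ} {x : ℝ × ℝ} {C : Set (ℝ × ℝ)}
    (hC : IsCompact C) (h : ∀ n, T^[n] x ∈ C) :
    Tendsto (fun n : ℕ => Metric.infDist (T^[n] x) (orbitLimit T x)) atTop (𝓝 0) := by
  rw [Metric.tendsto_atTop]
  intro ε hε
  have := eventually_mapsTo_of_isCompact_absorbing_of_isOpen_of_omegaLimit_subset atTop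
    (fun (n : ℕ) (p : ℝ × ℝ) => T^[n] p) {x} hC
    (Eventually.of_forall fun n => by rintro _ rfl; exact h n)
    (n := Metric.thickening ε (orbitLimit T x)) Metric.isOpen_thickening
    (Metric.self_subset_thickening hε _)
  obtain ⟨N, hN⟩ := eventually_atTop.1 this
  refine ⟨N, fun n hn => ?_⟩
  have h1 := hN n hn (mem_singleton x)
  rw [Metric.mem_thickening_iff_infDist_lt (orbitLimit_nonempty hC h)] at h1
  rw [Real.dist_eq, sub_zero, abs_of_nonneg Metric.infDist_nonneg]
  exact h1

/-- If the orbit of `x` converges to a periodic sequence, then its limit set is the range. -/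
lemma orbitLimit_eq_range {T : ℝ × ℝ → ℝ × ℝ} {x : ℝ × ℝ} {N : ℕ} (hN : 0 < N)
    {w : ℕ → ℝ × ℝ} (hw : ∀ i, w (i + N) = w i)
    (h : Tendsto (fun n => dist (T^[n] x) (w n)) atTop (𝓝 0)) :
    orbitLimit T x = range w := by
  have hper : ∀ i j, w (i + j * N) = w i := by
    intro i j
    induction j with
    | zero => simp
    | succ j ih => rw [Nat.succ_mul, ← add_assoc, hw, ih]
  have hfin : (range w).Finite := by
    refine ((finite_Iio N).image w).subset ?_
    rintro _ ⟨i, rfl⟩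
    refine ⟨i % N, Nat.mod_lt _ hN, ?_⟩
    conv_rhs => rw [← Nat.mod_add_div' i N]
    rw [hper]
  apply Subset.antisymm
  · intro z hz
    rw [← hfin.isClosed.closure_eq, Metric.mem_closure_iff]
    intro ε hε
    obtain ⟨M, hM⟩ := (Metric.tendsto_atTop.1 h) (ε / 2) (by positivity)
    obtain ⟨n, hn, hd⟩ := mem_orbitLimit.1 hz (ε / 2) (by positivity) M
    refine ⟨w n, ⟨n, rfl⟩, ?_⟩
    have h1 := hM n hn
    rw [Real.dist_eq, sub_zero, abs_of_nonneg dist_nonneg] at h1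
    have := dist_triangle_left z (w n) (T^[n] x)
    linarith
  · rintro _ ⟨i, rfl⟩
    rw [mem_orbitLimit]
    intro ε hε M
    obtain ⟨M', hM⟩ := (Metric.tendsto_atTop.1 h) ε hε
    have hle : M + M' ≤ (M + M') * N := Nat.le_mul_of_pos_right _ hN
    refine ⟨i + (M + M') * N, by omega, ?_⟩
    have h1 := hM (i + (M + M') * N) (by omega)
    rw [Real.dist_eq, sub_zero, abs_of_nonneg dist_nonneg, hper] at h1
    exact h1

lemma tendsto_infDist_range {T : ℝ × ℝ → ℝ × ℝ} {x : ℝ × ℝ} {w : ℕ → ℝ × ℝ}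
    (h : Tendsto (fun n => dist (T^[n] x) (w n)) atTop (𝓝 0)) :
    Tendsto (fun n : ℕ => Metric.infDist (T^[n] x) (range w)) atTop (𝓝 0) :=
  squeeze_zero (fun _ => Metric.infDist_nonneg)
    (fun n => Metric.infDist_le_dist_of_mem ⟨n, rfl⟩) h

/-! ### Contracting similarities and periodic limits. -/

/-- `T` restricted to the set `S` acts for `N` steps as a similarity of ratio `-lam`. -/
def SimilarOn (T : ℝ × ℝ → ℝ × ℝ) (lam : ℝ) (S : Set (ℝ × ℝ)) (N : ℕ) : Prop :=
  ∀ q ∈ S, ∀ q' ∈ S, ∀ i ≤ N, T^[i] q - T^[i] q' = (-lam) ^ i • (q - q')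

lemma SimilarOn.mono {T : ℝ × ℝ → ℝ × ℝ} {lam : ℝ} {S S' : Set (ℝ × ℝ)} {N : ℕ}
    (h : SimilarOn T lam S N) (hS : S' ⊆ S) : SimilarOn T lam S' N :=
  fun q hq q' hq' => h q (hS hq) q' (hS hq')

lemma SimilarOn.add {T : ℝ × ℝ → ℝ × ℝ} {lam : ℝ} {S S' : Set (ℝ × ℝ)} {N N' : ℕ}
    (h : SimilarOn T lam S N) (h' : SimilarOn T lam S' N') (hm : ∀ q ∈ S, T^[N] q ∈ S') :
    SimilarOn T lam S (N' + N) := by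
  intro q hq q' hq' i hi
  by_cases hiN : i ≤ N
  · exact h q hq q' hq' i hiN
  · obtain ⟨j, rfl⟩ := Nat.exists_eq_add_of_le' (not_le.1 hiN).le
    rw [Function.iterate_add_apply, Function.iterate_add_apply,
      h' _ (hm q hq) _ (hm q' hq') j (by omega), h q hq q' hq' N le_rfl, smul_smul, pow_add]

lemma SimilarOn.forall_of_mapsTo {T : ℝ × ℝ → ℝ × ℝ} {lam : ℝ} {S : Set (ℝ × ℝ)} {N : ℕ}
    (hN : 0 < N) (h : SimilarOn T lam S N) (hm : ∀ q ∈ S, T^[N] q ∈ S) (M : ℕ) :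
    SimilarOn T lam S M := by
  have key : ∀ j, SimilarOn T lam S (j * N) := by
    intro j
    induction j with
    | zero =>
      intro q _ q' _ i hi
      obtain rfl : i = 0 := by omega
      simp
    | succ j ih => rw [Nat.succ_mul]; exact h.add ih hm
  exact fun q hq q' hq' i hi =>
    key M q hq q' hq' i (hi.trans (Nat.le_mul_of_pos_right _ hN))

/-- A set that is mapped into itself by an iterate of `T`, all of whose iterates contract it,
attracts its orbits to one periodic orbit. -/
theorem exists_periodic_limit {T : ℝ × ℝ → ℝ × ℝ} {lam : ℝ} (h0 : 0 < lam) (h1 : lam < 1)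
    {S : Set (ℝ × ℝ)} {N : ℕ} (hN : 0 < N) (hne : S.Nonempty) (h : SimilarOn T lam S N)
    (hm : ∀ q ∈ S, T^[N] q ∈ S) :
    ∃ w : ℕ → ℝ × ℝ, (∀ i, w (i + N) = w i) ∧
      ∀ q ∈ S, Tendsto (fun n => dist (T^[n] q) (w n)) atTop (𝓝 0) := by
  have hall : ∀ q ∈ S, ∀ q' ∈ S, ∀ i, dist (T^[i] q) (T^[i] q') = lam ^ i * dist q q' := by
    intro q hq q' hq' i
    rw [dist_eq_norm, h.forall_of_mapsTo hN hm i q hq q' hq' i le_rfl, norm_smul, norm_pow,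
      norm_neg, Real.norm_of_nonneg h0.le, dist_eq_norm]
  obtain ⟨x, hx⟩ := hne
  set D := dist x (T^[N] x) with hD
  have hlN : lam ^ N < 1 := pow_lt_one₀ h0.le h1 hN.ne'
  have hstep : ∀ i j, dist (T^[i + j * N] x) (T^[i + (j + 1) * N] x)
      ≤ (lam ^ i * D) * (lam ^ N) ^ j := by
    intro i j
    have e : i + (j + 1) * N = (i + j * N) + N := by ring
    rw [e, Function.iterate_add_apply T (i + j * N) N, hall x hx _ (hm x hx), pow_add, pow_mul',
      ← hD]
    apply le_of_eq; ring
  -- `S` need not be closed and `T` may be discontinuous at the limit, so `w` is built from limits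
  -- along each residue class of times and not as the orbit of a fixed point of `T^[N]`.
  have hlim : ∀ i, ∃ z, Tendsto (fun j => T^[i + j * N] x) atTop (𝓝 z) := fun i =>
    cauchySeq_tendsto_of_complete (cauchySeq_of_le_geometric _ _ hlN (hstep i))
  choose w hw using hlim
  have hdist : ∀ i, dist (T^[i] x) (w i) ≤ lam ^ i * (D / (1 - lam ^ N)) := by
    intro i
    have := dist_le_of_le_geometric_of_tendsto _ _ hlN (hstep i) (hw i) 0
    simp only [zero_mul, add_zero, pow_zero, mul_one] at this
    rwa [mul_div_assoc] at this
  refine ⟨w, fun i => ?_, fun q hq => ?_⟩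
  · refine tendsto_nhds_unique (hw (i + N)) ?_
    have := (hw i).comp (tendsto_add_atTop_nat 1)
    refine this.congr fun j => ?_
    simp only [Function.comp, add_mul, one_mul, add_assoc, add_comm N]
  · refine squeeze_zero (fun _ => dist_nonneg)
      (g := fun n => lam ^ n * (dist q x + D / (1 - lam ^ N))) (fun n => ?_) ?_
    · have := dist_triangle (T^[n] q) (T^[n] x) (w n)
      rw [hall q hq x hx] at this
      have := hdist n
      nlinarith
    · have := (tendsto_pow_atTop_nhds_zero_of_lt_one h0.le h1).mul_const
        (dist q x + D / (1 - lam ^ N))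
      simpa using this

/-! ### Renormalization of interval maps with one jump. -/

/-- The interval `[c - d₁, c + d₂]` of first coordinates is visited by all orbits that start in
the section `S`. On its left part `T^[k]` is the first return, on its right part `T^[l]` is; in the
first coordinate the returns are affine, and they send `c` to the right and left end. -/
structure IsRenormInterval (T : ℝ × ℝ → ℝ × ℝ) (S : Set (ℝ × ℝ)) (lam c d₁ d₂ : ℝ) (k l : ℕ) :
    Prop where
  left_pos : 0 < d₁
  right_pos : 0 < d₂
  time_left_pos : 0 < k
  time_right_pos : 0 < l
  left_return : ∀ q ∈ S, c - d₁ ≤ q.1 → q.1 < c →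
    T^[k] q ∈ S ∧ (T^[k] q).1 = c + d₂ + lam ^ k * (q.1 - c)
  right_return : ∀ q ∈ S, c < q.1 → q.1 ≤ c + d₂ →
    T^[l] q ∈ S ∧ (T^[l] q).1 = c - d₁ + lam ^ l * (q.1 - c)
  left_similar : SimilarOn T lam {q | q ∈ S ∧ c - d₁ ≤ q.1 ∧ q.1 < c} k
  right_similar : SimilarOn T lam {q | q ∈ S ∧ c < q.1 ∧ q.1 ≤ c + d₂} l
  enter : ∀ q ∈ S, ∃ n, T^[n] q ∈ S ∧ c - d₁ ≤ (T^[n] q).1 ∧ (T^[n] q).1 ≤ c + d₂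

namespace IsRenormInterval

variable {T : ℝ × ℝ → ℝ × ℝ} {S : Set (ℝ × ℝ)} {lam c d₁ d₂ : ℝ} {k l : ℕ}

/-- Since `d₁ < lam ^ l * d₂`, the left return lands in the right part, so it can be followed by the
right return: `c` goes to `c + d₂` and then to `c - d₁ + lam ^ l * d₂`, the new right end. The right
return sends the whole right part below this end, so orbits enter the shorter interval. -/
lemma induce_right (h : IsRenormInterval T S lam c d₁ d₂ k l) (h0 : 0 < lam) (h1 : lam < 1)
    (hd : d₁ < lam ^ l * d₂) :
    IsRenormInterval T S lam c d₁ (lam ^ l * d₂ - d₁) (l + k) l := by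
  have hk : lam ^ k ≤ 1 := pow_le_one₀ h0.le h1.le
  have hl : lam ^ l ≤ 1 := pow_le_one₀ h0.le h1.le
  have hkp : 0 < lam ^ k := by positivity
  have hlp : 0 < lam ^ l := by positivity
  have p1 := h.left_pos
  have p2 := h.right_pos
  have hl2 : lam ^ l * d₂ ≤ d₂ := by nlinarith
  have hmid : ∀ q ∈ S, c - d₁ ≤ q.1 → q.1 < c → T^[k] q ∈ S ∧ c < (T^[k] q).1 ∧
      (T^[k] q).1 ≤ c + d₂ := by
    intro q hq ha hb
    obtain ⟨hS, e⟩ := h.left_return q hq ha hb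
    refine ⟨hS, ?_, ?_⟩
    · rw [e]; nlinarith
    · rw [e]; nlinarith
  refine ⟨p1, by linarith, by have := h.time_left_pos; omega, h.time_right_pos, ?_, ?_, ?_, ?_, ?_⟩
  · intro q hq ha hb
    obtain ⟨hS, e⟩ := h.left_return q hq ha hb
    obtain ⟨-, hc, hd'⟩ := hmid q hq ha hb
    obtain ⟨hS', e'⟩ := h.right_return _ hS hc hd'
    rw [Function.iterate_add_apply]
    refine ⟨hS', ?_⟩
    rw [e', e]; ring
  · intro q hq ha hb
    obtain ⟨hS, e⟩ := h.right_return q hq ha (by linarith)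
    exact ⟨hS, e⟩
  · exact h.left_similar.add h.right_similar fun q hq => hmid q hq.1 hq.2.1 hq.2.2
  · exact h.right_similar.mono fun q hq => ⟨hq.1, hq.2.1, by have := hq.2.2; linarith⟩
  · intro q hq
    obtain ⟨n, hS, ha, hb⟩ := h.enter q hq
    by_cases hle : (T^[n] q).1 ≤ c + (lam ^ l * d₂ - d₁)
    · exact ⟨n, hS, ha, hle⟩
    · push Not at hle
      obtain ⟨hS', e⟩ := h.right_return _ hS (by linarith) hb
      refine ⟨l + n, ?_⟩
      rw [Function.iterate_add_apply]
      refine ⟨hS', ?_, ?_⟩ <;> rw [e] <;> nlinarith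

/-- The mirror image of `induce_right`: the right return now lands in the left part, and the left
end moves. -/
lemma induce_left (h : IsRenormInterval T S lam c d₁ d₂ k l) (h0 : 0 < lam) (h1 : lam < 1)
    (hd : d₂ < lam ^ k * d₁) :
    IsRenormInterval T S lam c (lam ^ k * d₁ - d₂) d₂ k (k + l) := by
  have hk : lam ^ k ≤ 1 := pow_le_one₀ h0.le h1.le
  have hl : lam ^ l ≤ 1 := pow_le_one₀ h0.le h1.le
  have hkp : 0 < lam ^ k := by positivity
  have hlp : 0 < lam ^ l := by positivity
  have p1 := h.left_pos
  have p2 := h.right_pos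
  have hl2 : lam ^ k * d₁ ≤ d₁ := by nlinarith
  have hmid : ∀ q ∈ S, c < q.1 → q.1 ≤ c + d₂ → T^[l] q ∈ S ∧ c - d₁ ≤ (T^[l] q).1 ∧
      (T^[l] q).1 < c := by
    intro q hq ha hb
    obtain ⟨hS, e⟩ := h.right_return q hq ha hb
    refine ⟨hS, ?_, ?_⟩
    · rw [e]; nlinarith
    · rw [e]; nlinarith
  refine ⟨by linarith, p2, h.time_left_pos, by have := h.time_left_pos; omega, ?_, ?_, ?_, ?_, ?_⟩
  · intro q hq ha hb
    obtain ⟨hS, e⟩ := h.left_return q hq (by linarith) hb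
    exact ⟨hS, e⟩
  · intro q hq ha hb
    obtain ⟨hS, e⟩ := h.right_return q hq ha hb
    obtain ⟨-, hc, hd'⟩ := hmid q hq ha hb
    obtain ⟨hS', e'⟩ := h.left_return _ hS hc hd'
    rw [Function.iterate_add_apply]
    refine ⟨hS', ?_⟩
    rw [e', e]; ring
  · exact h.left_similar.mono fun q hq => ⟨hq.1, by have := hq.2.1; linarith, hq.2.2⟩
  · exact h.right_similar.add h.left_similar fun q hq => hmid q hq.1 hq.2.1 hq.2.2
  · intro q hq
    obtain ⟨n, hS, ha, hb⟩ := h.enter q hq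
    by_cases hle : c - (lam ^ k * d₁ - d₂) ≤ (T^[n] q).1
    · exact ⟨n, hS, hle, hb⟩
    · push Not at hle
      obtain ⟨hS', e⟩ := h.left_return _ hS ha (by linarith)
      refine ⟨k + n, ?_⟩
      rw [Function.iterate_add_apply]
      refine ⟨hS', ?_, ?_⟩ <;> rw [e] <;> nlinarith

lemma enter_ge (h : IsRenormInterval T S lam c d₁ d₂ k l) (hc : ∀ q ∈ S, q.1 ≠ c)
    {q : ℝ × ℝ} (hq : q ∈ S) (M : ℕ) :
    ∃ n ≥ M, T^[n] q ∈ S ∧ c - d₁ ≤ (T^[n] q).1 ∧ (T^[n] q).1 ≤ c + d₂ := by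
  induction M with
  | zero =>
    obtain ⟨n, hn⟩ := h.enter q hq
    exact ⟨n, Nat.zero_le _, hn⟩
  | succ M ih =>
    obtain ⟨n, hn, hS, ha, hb⟩ := ih
    have : ∃ j > 0, T^[j] (T^[n] q) ∈ S := by
      rcases lt_or_gt_of_ne (hc _ hS) with hlt | hgt
      · exact ⟨k, h.time_left_pos, (h.left_return _ hS ha hlt).1⟩
      · exact ⟨l, h.time_right_pos, (h.right_return _ hS hgt hb).1⟩
    obtain ⟨j, hj, hS'⟩ := this
    obtain ⟨i, hi⟩ := h.enter _ hS'
    refine ⟨i + (j + n), by omega, ?_⟩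
    rwa [Function.iterate_add_apply, Function.iterate_add_apply]

/-- A left return increases the first coordinate by at least `d₂`, because `lam ^ k ≤ 1` and `q.1 <
c`. An orbit making only left returns would leave the bounded interval. -/
lemma visit_right (h : IsRenormInterval T S lam c d₁ d₂ k l) (hc : ∀ q ∈ S, q.1 ≠ c)
    (h0 : 0 < lam) (h1 : lam < 1) {q : ℝ × ℝ} (hq : q ∈ S) (M : ℕ) :
    ∃ n ≥ M, T^[n] q ∈ S ∧ c < (T^[n] q).1 ∧ (T^[n] q).1 ≤ c + d₂ := by
  by_contra! hcon
  have hk : lam ^ k ≤ 1 := pow_le_one₀ h0.le h1.le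
  have hkp : 0 < lam ^ k := by positivity
  have p2 := h.right_pos
  have key : ∀ j : ℕ, ∃ n ≥ M, T^[n] q ∈ S ∧ c - d₁ + j * d₂ ≤ (T^[n] q).1 ∧
      (T^[n] q).1 ≤ c + d₂ := by
    intro j
    induction j with
    | zero => simpa using h.enter_ge hc hq M
    | succ j ih =>
      obtain ⟨n, hn, hS, ha, hb⟩ := ih
      have hlt : (T^[n] q).1 < c := by
        by_contra hge
        exact absurd hb (not_le.2 (hcon n hn hS (lt_of_le_of_ne (not_lt.1 hge) (hc _ hS).symm)))
      have hjd : 0 ≤ (j : ℝ) * d₂ := by positivity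
      obtain ⟨hS', e⟩ := h.left_return _ hS (by linarith) hlt
      refine ⟨k + n, by omega, ?_⟩
      rw [Function.iterate_add_apply]
      refine ⟨hS', ?_, ?_⟩ <;> rw [e]
      · push_cast; nlinarith
      · nlinarith
  obtain ⟨j, hj⟩ := exists_nat_gt ((d₁ + d₂) / d₂)
  rw [div_lt_iff₀ p2] at hj
  obtain ⟨n, -, -, ha, hb⟩ := key j
  linarith

/-- Each right return decreases the first coordinate by at least `d₁`. -/
lemma visit_left (h : IsRenormInterval T S lam c d₁ d₂ k l) (hc : ∀ q ∈ S, q.1 ≠ c)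
    (h0 : 0 < lam) (h1 : lam < 1) {q : ℝ × ℝ} (hq : q ∈ S) (M : ℕ) :
    ∃ n ≥ M, T^[n] q ∈ S ∧ c - d₁ ≤ (T^[n] q).1 ∧ (T^[n] q).1 < c := by
  by_contra! hcon
  have hk : lam ^ l ≤ 1 := pow_le_one₀ h0.le h1.le
  have hkp : 0 < lam ^ l := by positivity
  have p2 := h.left_pos
  have key : ∀ j : ℕ, ∃ n ≥ M, T^[n] q ∈ S ∧ c - d₁ ≤ (T^[n] q).1 ∧
      (T^[n] q).1 ≤ c + d₂ - j * d₁ := by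
    intro j
    induction j with
    | zero => simpa using h.enter_ge hc hq M
    | succ j ih =>
      obtain ⟨n, hn, hS, ha, hb⟩ := ih
      have hlt : c < (T^[n] q).1 := lt_of_le_of_ne (hcon n hn hS ha) (hc _ hS).symm
      have hjd : 0 ≤ (j : ℝ) * d₁ := by positivity
      obtain ⟨hS', e⟩ := h.right_return _ hS hlt (by linarith)
      refine ⟨l + n, by omega, ?_⟩
      rw [Function.iterate_add_apply]
      refine ⟨hS', ?_, ?_⟩ <;> rw [e]
      · nlinarith
      · push_cast; nlinarith
  obtain ⟨j, hj⟩ := exists_nat_gt ((d₁ + d₂) / d₁)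
  rw [div_lt_iff₀ p2] at hj
  obtain ⟨n, -, -, ha, hb⟩ := key j
  linarith

/-- If neither induction step is possible, then the left part is mapped to itself by the
composition of the two returns, and it is visited by all orbits. -/
lemma left_mapsTo_of_terminal (h : IsRenormInterval T S lam c d₁ d₂ k l)
    (hc : ∀ q ∈ S, q.1 ≠ c) (h0 : 0 < lam) (hl : lam ^ l * d₂ ≤ d₁) (hk : lam ^ k * d₁ ≤ d₂) :
    (∀ q ∈ {q | q ∈ S ∧ c - d₁ ≤ q.1 ∧ q.1 < c},
      T^[l + k] q ∈ {q | q ∈ S ∧ c - d₁ ≤ q.1 ∧ q.1 < c}) ∧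
    SimilarOn T lam {q | q ∈ S ∧ c - d₁ ≤ q.1 ∧ q.1 < c} (l + k) := by
  have hkp : 0 < lam ^ k := by positivity
  have hlp : 0 < lam ^ l := by positivity
  have hmid : ∀ q ∈ {q | q ∈ S ∧ c - d₁ ≤ q.1 ∧ q.1 < c},
      T^[k] q ∈ {q | q ∈ S ∧ c < q.1 ∧ q.1 ≤ c + d₂} := by
    rintro q ⟨hq, ha, hb⟩
    obtain ⟨hS, e⟩ := h.left_return q hq ha hb
    refine ⟨hS, lt_of_le_of_ne ?_ (hc _ hS).symm, ?_⟩ <;> rw [e] <;> nlinarith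
  refine ⟨fun q hq => ?_, h.left_similar.add h.right_similar hmid⟩
  obtain ⟨hS, ha, hb⟩ := hmid q hq
  obtain ⟨hS', e⟩ := h.right_return _ hS ha hb
  rw [Function.iterate_add_apply]
  refine ⟨hS', ?_, lt_of_le_of_ne ?_ (hc _ hS')⟩ <;> rw [e] <;> nlinarith

end IsRenormInterval

/-! ### Cantor limit sets from narrow blocks. -/

/-- A part `A` of the section `S` of width `δ` which is visited by all orbits, on which `T` is a
similarity for `m` steps, and in which all orbits accumulate at two different first coordinates. -/
structure IsBlock (T : ℝ × ℝ → ℝ × ℝ) (S : Set (ℝ × ℝ)) (lam : ℝ) (A : Set (ℝ × ℝ)) (m : ℕ)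
    (δ : ℝ) : Prop where
  subset : A ⊆ S
  similar : SimilarOn T lam A m
  width : ∀ q ∈ A, ∀ q' ∈ A, |q.1 - q'.1| ≤ δ
  accumulate : ∃ g g' : ℝ, g ≠ g' ∧ ∀ b ∈ ({g, g'} : Set ℝ), ∀ x ∈ S, ∀ η > 0, ∀ M : ℕ,
    ∃ n ≥ M, T^[n] x ∈ A ∧ |(T^[n] x).1 - b| < η

lemma IsBlock.visit {T : ℝ × ℝ → ℝ × ℝ} {S : Set (ℝ × ℝ)} {lam : ℝ} {A : Set (ℝ × ℝ)} {m : ℕ}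
    {δ : ℝ} (h : IsBlock T S lam A m δ) {x : ℝ × ℝ} (hx : x ∈ S) (M : ℕ) :
    ∃ n ≥ M, T^[n] x ∈ A := by
  obtain ⟨g, g', -, hg⟩ := h.accumulate
  obtain ⟨n, hn, hA, -⟩ := hg g (by simp) x hx 1 one_pos M
  exact ⟨n, hn, hA⟩

/-- Every late point of an orbit is in an iterate of one of two blocks of width `δ`, before the
end of the excursion that starts there. -/
def HasBlocks (T : ℝ × ℝ → ℝ × ℝ) (S : Set (ℝ × ℝ)) (lam δ : ℝ) : Prop :=
  ∃ A₁ A₂ m₁ m₂, IsBlock T S lam A₁ m₁ δ ∧ IsBlock T S lam A₂ m₂ δ ∧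
    ∀ x ∈ S, ∃ N₀, ∀ n ≥ N₀, ∃ s i, n = i + s ∧
      ((T^[s] x ∈ A₁ ∧ i < m₁) ∨ (T^[s] x ∈ A₂ ∧ i < m₂))

section blocks

variable {T : ℝ × ℝ → ℝ × ℝ} {S : Set (ℝ × ℝ)} {lam : ℝ}

lemma HasBlocks.exists_late {δ : ℝ} (h : HasBlocks T S lam δ) {x : ℝ × ℝ} (hx : x ∈ S) (M : ℕ) :
    ∃ N₀, ∀ n ≥ N₀, ∃ A m s i, IsBlock T S lam A m δ ∧ M ≤ s ∧ n = i + s ∧ T^[s] x ∈ A ∧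
      i < m := by
  obtain ⟨A₁, A₂, m₁, m₂, h₁, h₂, hcov⟩ := h
  obtain ⟨N₀, hN⟩ := hcov x hx
  refine ⟨N₀ + M + m₁ + m₂, fun n hn => ?_⟩
  obtain ⟨s, i, e, ⟨hA, hi⟩ | ⟨hA, hi⟩⟩ := hN n (by omega)
  · exact ⟨A₁, m₁, s, i, h₁, by omega, e, hA, hi⟩
  · exact ⟨A₂, m₂, s, i, h₂, by omega, e, hA, hi⟩

lemma SimilarOn.dist_eq {A : Set (ℝ × ℝ)} {m : ℕ} (h : SimilarOn T lam A m) (h0 : 0 < lam)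
    {q q' : ℝ × ℝ} (hq : q ∈ A) (hq' : q' ∈ A) {i : ℕ} (hi : i ≤ m) :
    dist (T^[i] q) (T^[i] q') = lam ^ i * dist q q' := by
  rw [dist_eq_norm, h q hq q' hq' i hi, norm_smul, norm_pow, norm_neg, Real.norm_of_nonneg h0.le,
    dist_eq_norm]

/-- A late point of the orbit of `x` near `z` lies `i` steps after a visit to a narrow block. The
orbit of `y` also visits this block late, at nearly the same height, and the next `i` steps do not
increase the distance. -/
lemma orbitLimit_subset_of_hasBlocks (h0 : 0 < lam) (h1 : lam < 1)
    (hy : ∀ q ∈ S, ∀ ε > 0, ∃ N, ∀ n ≥ N, T^[n] q ∈ S → |(T^[n] q).2 - 1| < ε)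
    (hB : ∀ δ > 0, HasBlocks T S lam δ) {x y : ℝ × ℝ} (hx : x ∈ S) (hyS : y ∈ S) :
    orbitLimit T x ⊆ orbitLimit T y := by
  intro z hz
  rw [mem_orbitLimit]
  intro ε hε N
  obtain ⟨Mx, hMx⟩ := hy x hx (ε / 4) (by positivity)
  obtain ⟨My, hMy⟩ := hy y hyS (ε / 4) (by positivity)
  obtain ⟨N₀, hN₀⟩ := (hB (ε / 4) (by positivity)).exists_late hx Mx
  obtain ⟨n, hn, hd⟩ := mem_orbitLimit.1 hz (ε / 2) (by positivity) N₀
  obtain ⟨A, m, s, i, hblk, hs, rfl, hA, hi⟩ := hN₀ n hn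
  obtain ⟨t, ht, htA⟩ := hblk.visit hyS (N + My)
  refine ⟨i + t, by omega, ?_⟩
  have e := hblk.similar.dist_eq h0 htA hA hi.le
  rw [← Function.iterate_add_apply, ← Function.iterate_add_apply] at e
  have hw := hblk.width _ htA _ hA
  have hu := hMx s hs (hblk.subset hA)
  have hv := hMy t (by omega) (hblk.subset htA)
  have hle : dist (T^[t] y) (T^[s] x) ≤ ε / 2 := by
    rw [Prod.dist_eq, Real.dist_eq, Real.dist_eq]
    refine max_le (by linarith) ?_
    rw [abs_lt] at hu hv
    rw [abs_le]; constructor <;> linarith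
  have hl : lam ^ i ≤ 1 := pow_le_one₀ h0.le h1.le
  have hnn : 0 ≤ dist (T^[t] y) (T^[s] x) := dist_nonneg
  have := dist_triangle (T^[i + t] y) (T^[i + s] x) z
  nlinarith

/-- An accumulation point of visits to a block is carried along by the similarity. -/
lemma IsBlock.mem_orbitLimit {A : Set (ℝ × ℝ)} {m : ℕ} {δ : ℝ} (hblk : IsBlock T S lam A m δ)
    (h0 : 0 < lam) (h1 : lam < 1)
    (hy : ∀ q ∈ S, ∀ ε > 0, ∃ N, ∀ n ≥ N, T^[n] q ∈ S → |(T^[n] q).2 - 1| < ε)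
    {x : ℝ × ℝ} (hx : x ∈ S) {b : ℝ}
    (hb : ∀ η > 0, ∀ M : ℕ, ∃ n ≥ M, T^[n] x ∈ A ∧ |(T^[n] x).1 - b| < η)
    {q : ℝ × ℝ} (hq : q ∈ A) {i : ℕ} (hi : i ≤ m) :
    T^[i] q + (-lam) ^ i • (((b, 1) : ℝ × ℝ) - q) ∈ orbitLimit T x := by
  rw [_root_.mem_orbitLimit]
  intro ε hε N
  obtain ⟨M, hM⟩ := hy x hx ε hε
  obtain ⟨n, hn, hA, hnb⟩ := hb ε hε (N + M)
  refine ⟨i + n, by omega, ?_⟩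
  have hu := hM n (by omega) (hblk.subset hA)
  have e := hblk.similar _ hA q hq i hi
  have e2 : T^[i + n] x - (T^[i] q + (-lam) ^ i • (((b, 1) : ℝ × ℝ) - q))
      = (-lam) ^ i • (T^[n] x - (b, 1)) := by
    rw [Function.iterate_add_apply, ← sub_sub, e, ← smul_sub]
    congr 1; abel
  rw [dist_eq_norm, e2, norm_smul, norm_pow, norm_neg, Real.norm_of_nonneg h0.le]
  have hl : lam ^ i ≤ 1 := pow_le_one₀ h0.le h1.le
  have hlt : ‖T^[n] x - (b, 1)‖ < ε := by
    rw [Prod.norm_def, Prod.fst_sub, Prod.snd_sub, Real.norm_eq_abs, Real.norm_eq_abs]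
    exact max_lt hnb hu
  have : 0 ≤ ‖T^[n] x - (b, 1)‖ := norm_nonneg _
  nlinarith

/-- Near `z` the orbit is `i` steps after a visit to a narrow block. The two accumulation points of
that block are carried by the similarity to two distinct points of the limit set near `z`. -/
lemma preperfect_orbitLimit (h0 : 0 < lam) (h1 : lam < 1)
    (hy : ∀ q ∈ S, ∀ ε > 0, ∃ N, ∀ n ≥ N, T^[n] q ∈ S → |(T^[n] q).2 - 1| < ε)
    (hB : ∀ δ > 0, HasBlocks T S lam δ) {x : ℝ × ℝ} (hx : x ∈ S) :
    Preperfect (orbitLimit T x) := by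
  rw [preperfect_iff_nhds]
  intro z hz U hU
  obtain ⟨ε, hε, hUε⟩ := Metric.mem_nhds_iff.1 hU
  obtain ⟨M, hM⟩ := hy x hx (ε / 4) (by positivity)
  obtain ⟨N₀, hN₀⟩ := (hB (ε / 4) (by positivity)).exists_late hx M
  obtain ⟨n, hn, hd⟩ := mem_orbitLimit.1 hz (ε / 4) (by positivity) N₀
  obtain ⟨A, m, s, i, hblk, hs, rfl, hA, hi⟩ := hN₀ n hn
  obtain ⟨g, g', hgg, hg⟩ := hblk.accumulate
  have hmem : ∀ b ∈ ({g, g'} : Set ℝ),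
      T^[i] (T^[s] x) + (-lam) ^ i • (((b, 1) : ℝ × ℝ) - T^[s] x) ∈ U ∩ orbitLimit T x := by
    intro b hb
    refine ⟨hUε ?_, hblk.mem_orbitLimit h0 h1 hy hx (hg b hb x hx) hA hi.le⟩
    have hgb : |b - (T^[s] x).1| ≤ ε / 2 := by
      obtain ⟨t, -, htA, htb⟩ := hg b hb x hx (ε / 4) (by positivity) 0
      have := hblk.width _ htA _ hA
      rw [abs_lt] at htb
      rw [abs_le] at this ⊢
      constructor <;> linarith
    have hu := hM s hs (hblk.subset hA)
    have hnorm : ‖((b, 1) : ℝ × ℝ) - T^[s] x‖ ≤ ε / 2 := by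
      rw [Prod.norm_def, Prod.fst_sub, Prod.snd_sub, Real.norm_eq_abs, Real.norm_eq_abs]
      refine max_le hgb ?_
      rw [abs_sub_comm]; linarith
    have hl : lam ^ i ≤ 1 := pow_le_one₀ h0.le h1.le
    rw [Metric.mem_ball]
    have h2 : dist (T^[i] (T^[s] x) + (-lam) ^ i • (((b, 1) : ℝ × ℝ) - T^[s] x))
        (T^[i] (T^[s] x)) ≤ ε / 2 := by
      rw [dist_eq_norm, add_sub_cancel_left, norm_smul, norm_pow, norm_neg,
        Real.norm_of_nonneg h0.le]
      have : 0 ≤ ‖((b, 1) : ℝ × ℝ) - T^[s] x‖ := norm_nonneg _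
      nlinarith
    rw [Function.iterate_add_apply] at hd
    have := dist_triangle (T^[i] (T^[s] x) + (-lam) ^ i • (((b, 1) : ℝ × ℝ) - T^[s] x))
      (T^[i] (T^[s] x)) z
    linarith
  -- At most one of the two points can equal `z`, as the similarity is injective.
  by_contra! hcon
  have e := (hcon _ (hmem g (by simp))).trans (hcon _ (hmem g' (by simp))).symm
  have hne : (-lam) ^ i ≠ 0 := pow_ne_zero _ (by linarith)
  have e1 := congrArg Prod.fst (smul_right_injective _ hne (add_left_cancel e))
  simp only [Prod.fst_sub, sub_left_inj] at e1
  exact hgg e1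

lemma volume_iUnion_closedBall_geometric_le (h0 : 0 < lam) (h1 : lam < 1) {δ : ℝ} (hδ : 0 ≤ δ)
    (a : ℕ → ℝ) (m : ℕ) :
    MeasureTheory.volume (⋃ i ∈ Finset.range m, Metric.closedBall (a i) (lam ^ i * δ)) ≤
      ENNReal.ofReal (2 * δ * (1 - lam)⁻¹) := by
  refine (MeasureTheory.measure_biUnion_finset_le _ _).trans ?_
  simp only [Real.volume_closedBall]
  rw [← ENNReal.ofReal_sum_of_nonneg fun i _ => by positivity]
  apply ENNReal.ofReal_le_ofReal
  have e : ∀ i, 2 * (lam ^ i * δ) = 2 * δ * lam ^ i := fun i => by ring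
  simp only [e, ← Finset.mul_sum]
  refine mul_le_mul_of_nonneg_left ?_ (by positivity)
  rw [← tsum_geometric_of_lt_one h0.le h1]
  exact (summable_geometric_of_lt_one h0.le h1).sum_le_tsum _ fun i _ => by positivity

/-- During an excursion the blocks have widths at most `lam ^ i * δ`. Summing the geometric series
for two blocks covers the late orbit by closed intervals of total length at most `4 * δ / (1 -
lam)`, whatever the lengths of the excursions. -/
lemma volume_fst_image_orbitLimit (h0 : 0 < lam) (h1 : lam < 1)
    (hB : ∀ δ > 0, HasBlocks T S lam δ) {x : ℝ × ℝ} (hx : x ∈ S) :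
    MeasureTheory.volume (Prod.fst '' orbitLimit T x) = 0 := by
  have key : ∀ δ > 0, MeasureTheory.volume (Prod.fst '' orbitLimit T x) ≤
      ENNReal.ofReal (4 * δ * (1 - lam)⁻¹) := by
    intro δ hδ
    obtain ⟨A₁, A₂, m₁, m₂, h₁, h₂, hcov⟩ := hB δ hδ
    obtain ⟨N₀, hN⟩ := hcov x hx
    obtain ⟨t₁, -, ht₁⟩ := h₁.visit hx 0
    obtain ⟨t₂, -, ht₂⟩ := h₂.visit hx 0
    set U : (ℕ → ℝ) → ℕ → Set ℝ := fun a m =>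
      ⋃ i ∈ Finset.range m, Metric.closedBall (a i) (lam ^ i * δ) with hU
    have hUc : ∀ a m, IsClosed (U a m) := fun a m =>
      isClosed_biUnion_finset fun i _ => Metric.isClosed_closedBall
    have hmem : ∀ {A m s t i}, IsBlock T S lam A m δ → T^[s] x ∈ A → T^[t] x ∈ A → i < m →
        (T^[i + s] x).1 ∈ U (fun i => (T^[i] (T^[t] x)).1) m := by
      intro A m s t i hblk hs ht hi
      simp only [hU, mem_iUnion, Finset.mem_range]
      refine ⟨i, hi, ?_⟩
      rw [Metric.mem_closedBall, Real.dist_eq, Function.iterate_add_apply]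
      have e := congrArg Prod.fst (hblk.similar _ hs _ ht i hi.le)
      simp only [Prod.fst_sub, Prod.smul_fst, smul_eq_mul] at e
      rw [e, abs_mul, abs_pow, abs_neg, abs_of_pos h0]
      exact mul_le_mul_of_nonneg_left (hblk.width _ hs _ ht) (by positivity)
    have hsub : orbitLimit T x ⊆ Prod.fst ⁻¹' (U (fun i => (T^[i] (T^[t₁] x)).1) m₁ ∪
        U (fun i => (T^[i] (T^[t₂] x)).1) m₂) := by
      refine orbitLimit_subset_of_eventually_mem
        (((hUc _ _).union (hUc _ _)).preimage continuous_fst) N₀ fun n hn => ?_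
      obtain ⟨s, i, rfl, ⟨hA, hi⟩ | ⟨hA, hi⟩⟩ := hN n hn
      · exact Or.inl (hmem h₁ hA ht₁ hi)
      · exact Or.inr (hmem h₂ hA ht₂ hi)
    have hpos : 0 ≤ 2 * δ * (1 - lam)⁻¹ := by
      have := inv_nonneg.2 (sub_nonneg.2 h1.le)
      positivity
    calc MeasureTheory.volume (Prod.fst '' orbitLimit T x)
        ≤ MeasureTheory.volume (U (fun i => (T^[i] (T^[t₁] x)).1) m₁ ∪
          U (fun i => (T^[i] (T^[t₂] x)).1) m₂) :=
          MeasureTheory.measure_mono (image_subset_iff.2 hsub)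
      _ ≤ ENNReal.ofReal (2 * δ * (1 - lam)⁻¹) + ENNReal.ofReal (2 * δ * (1 - lam)⁻¹) :=
          (MeasureTheory.measure_union_le _ _).trans
            (add_le_add (volume_iUnion_closedBall_geometric_le h0 h1 hδ.le _ _)
              (volume_iUnion_closedBall_geometric_le h0 h1 hδ.le _ _))
      _ = ENNReal.ofReal (4 * δ * (1 - lam)⁻¹) := by
          rw [← ENNReal.ofReal_add hpos hpos]; congr 1; ring
  have hlim : Tendsto (fun n : ℕ => ENNReal.ofReal (4 * (1 / ((n : ℝ) + 1)) * (1 - lam)⁻¹)) atTop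
      (𝓝 0) := by
    have := ((tendsto_one_div_add_atTop_nhds_zero_nat (𝕜 := ℝ)).const_mul 4).mul_const (1 - lam)⁻¹
    have := ENNReal.tendsto_ofReal this
    simpa using this
  exact le_antisymm (ge_of_tendsto' hlim fun n => key _ (by positivity)) zero_le

lemma subsingleton_of_isPreconnected_of_volume_eq_zero {s : Set ℝ} (hs : IsPreconnected s)
    (h : MeasureTheory.volume s = 0) : s.Subsingleton := by
  intro a ha b hb
  by_contra hne
  wlog hlt : a < b generalizing a b
  · exact this hb ha (Ne.symm hne) (lt_of_le_of_ne (not_lt.1 hlt) (Ne.symm hne))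
  have := MeasureTheory.measure_mono_null (hs.Icc_subset ha hb) h
  rw [Real.volume_Icc, ENNReal.ofReal_eq_zero] at this
  linarith

/-- If all orbits are covered by blocks of arbitrarily small width, then all of them have the same
limit set, and it is a Cantor set. -/
theorem isCantorSet_orbitLimit (h0 : 0 < lam) (h1 : lam < 1)
    (hy : ∀ q ∈ S, ∀ ε > 0, ∃ N, ∀ n ≥ N, T^[n] q ∈ S → |(T^[n] q).2 - 1| < ε)
    (hB : ∀ δ > 0, HasBlocks T S lam δ) {x : ℝ × ℝ} (hx : x ∈ S) {C : Set (ℝ × ℝ)}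
    (hC : IsCompact C) (hxC : ∀ n, T^[n] x ∈ C) {F : Set ℝ} (hF : F.Countable)
    (hxF : ∀ z ∈ orbitLimit T x, z.2 ∈ F) : IsCantorSet (orbitLimit T x) := by
  refine ⟨orbitLimit_nonempty hC hxC, isCompact_orbitLimit hC hxC,
    ⟨isClosed_orbitLimit T x, preperfect_orbitLimit h0 h1 hy hB hx⟩, ?_⟩
  intro t ht hpre p hp q hq
  refine Prod.ext ?_ ?_
  · refine subsingleton_of_isPreconnected_of_volume_eq_zero
      (hpre.image Prod.fst continuous_fst.continuousOn) ?_ ⟨p, hp, rfl⟩ ⟨q, hq, rfl⟩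
    exact MeasureTheory.measure_mono_null (image_mono ht) (volume_fst_image_orbitLimit h0 h1 hB hx)
  · refine subsingleton_of_isPreconnected_of_volume_eq_zero
      (hpre.image Prod.snd continuous_snd.continuousOn) ?_ ⟨p, hp, rfl⟩ ⟨q, hq, rfl⟩
    refine MeasureTheory.measure_mono_null ?_ (hF.measure_zero MeasureTheory.volume)
    rintro _ ⟨r, hr, rfl⟩
    exact hxF r (ht hr)

end blocks

/-- The blocks are the two sides of one short interval. Still shorter intervals show that orbits
accumulate at `c` from both sides, and one more return carries this accumulation to the ends of the
interval. -/
lemma IsRenormInterval.hasBlocks {T : ℝ × ℝ → ℝ × ℝ} {S : Set (ℝ × ℝ)} {lam c : ℝ}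
    {d₁ d₂ : ℕ → ℝ} {k l : ℕ → ℕ} (h0 : 0 < lam) (h1 : lam < 1) (hc : ∀ q ∈ S, q.1 ≠ c)
    (h : ∀ n, IsRenormInterval T S lam c (d₁ n) (d₂ n) (k n) (l n))
    (hd : ∀ δ > 0, ∃ n, d₁ n < δ ∧ d₂ n < δ) {δ : ℝ} (hδ : 0 < δ) : HasBlocks T S lam δ := by
  obtain ⟨N, hN₁, hN₂⟩ := hd δ hδ
  have p₁ := (h N).left_pos
  have p₂ := (h N).right_pos
  have hk : lam ^ k N ≤ 1 := pow_le_one₀ h0.le h1.le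
  have hl : lam ^ l N ≤ 1 := pow_le_one₀ h0.le h1.le
  have hkp : 0 < lam ^ k N := by positivity
  have hlp : 0 < lam ^ l N := by positivity
  have visitL : ∀ x ∈ S, ∀ η > 0, ∀ M : ℕ, ∃ n ≥ M,
      T^[n] x ∈ S ∧ c - d₁ N ≤ (T^[n] x).1 ∧ (T^[n] x).1 < c ∧ |(T^[n] x).1 - c| < η := by
    intro x hx η hη M
    obtain ⟨N', hN', -⟩ := hd (min η (d₁ N)) (lt_min hη p₁)
    obtain ⟨n, hn, hS, ha, hb⟩ := (h N').visit_left hc h0 h1 hx M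
    have := min_le_left η (d₁ N)
    have := min_le_right η (d₁ N)
    refine ⟨n, hn, hS, by linarith, hb, ?_⟩
    rw [abs_lt]; constructor <;> linarith
  have visitR : ∀ x ∈ S, ∀ η > 0, ∀ M : ℕ, ∃ n ≥ M,
      T^[n] x ∈ S ∧ c < (T^[n] x).1 ∧ (T^[n] x).1 ≤ c + d₂ N ∧ |(T^[n] x).1 - c| < η := by
    intro x hx η hη M
    obtain ⟨N', -, hN'⟩ := hd (min η (d₂ N)) (lt_min hη p₂)
    obtain ⟨n, hn, hS, ha, hb⟩ := (h N').visit_right hc h0 h1 hx M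
    have := min_le_left η (d₂ N)
    have := min_le_right η (d₂ N)
    refine ⟨n, hn, hS, ha, by linarith, ?_⟩
    rw [abs_lt]; constructor <;> linarith
  refine ⟨{q | q ∈ S ∧ c - d₁ N ≤ q.1 ∧ q.1 < c}, {q | q ∈ S ∧ c < q.1 ∧ q.1 ≤ c + d₂ N},
    k N, l N, ⟨fun q hq => hq.1, (h N).left_similar, ?_, c, c - d₁ N, by linarith, ?_⟩,
    ⟨fun q hq => hq.1, (h N).right_similar, ?_, c, c + d₂ N, by linarith, ?_⟩, ?_⟩
  · rintro q ⟨-, ha, hb⟩ q' ⟨-, ha', hb'⟩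
    rw [abs_le]; constructor <;> linarith
  · rintro b (rfl | rfl) x hx η hη M
    · obtain ⟨n, hn, hS, ha, hb, hc'⟩ := visitL x hx η hη M
      exact ⟨n, hn, ⟨hS, ha, hb⟩, hc'⟩
    · obtain ⟨n, hn, hS, ha, hb, hc'⟩ := visitR x hx (min η (d₁ N)) (lt_min hη p₁) M
      obtain ⟨hS', e⟩ := (h N).right_return _ hS ha hb
      have m₁ := min_le_left η (d₁ N)
      have m₂ := min_le_right η (d₁ N)
      rw [abs_of_pos (by linarith)] at hc'
      refine ⟨l N + n, by omega, ?_⟩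
      rw [Function.iterate_add_apply, e]
      refine ⟨⟨hS', ?_, ?_⟩, ?_⟩
      · rw [e]; nlinarith
      · rw [e]; nlinarith
      · rw [add_sub_cancel_left, abs_of_nonneg (by nlinarith)]; nlinarith
  · rintro q ⟨-, ha, hb⟩ q' ⟨-, ha', hb'⟩
    rw [abs_le]; constructor <;> linarith
  · rintro b (rfl | rfl) x hx η hη M
    · obtain ⟨n, hn, hS, ha, hb, hc'⟩ := visitR x hx η hη M
      exact ⟨n, hn, ⟨hS, ha, hb⟩, hc'⟩
    · obtain ⟨n, hn, hS, ha, hb, hc'⟩ := visitL x hx (min η (d₂ N)) (lt_min hη p₂) M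
      obtain ⟨hS', e⟩ := (h N).left_return _ hS ha hb
      have m₁ := min_le_left η (d₂ N)
      have m₂ := min_le_right η (d₂ N)
      rw [abs_of_neg (by linarith)] at hc'
      refine ⟨k N + n, by omega, ?_⟩
      rw [Function.iterate_add_apply, e]
      refine ⟨⟨hS', ?_, ?_⟩, ?_⟩
      · rw [e]; nlinarith
      · rw [e]; nlinarith
      · rw [add_sub_cancel_left, abs_of_nonpos (by nlinarith)]; nlinarith
  · intro x hx
    obtain ⟨N₀, hS₀, ha₀, hb₀⟩ := (h N).enter x hx
    refine ⟨N₀, fun n hn => ?_⟩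
    induction n, hn using Nat.le_induction with
    | base =>
      refine ⟨N₀, 0, by simp, ?_⟩
      rcases lt_or_gt_of_ne (hc _ hS₀) with hlt | hgt
      · exact Or.inl ⟨⟨hS₀, ha₀, hlt⟩, (h N).time_left_pos⟩
      · exact Or.inr ⟨⟨hS₀, hgt, hb₀⟩, (h N).time_right_pos⟩
    | succ n hn ih =>
      have restart : T^[n + 1] x ∈ S → c - d₁ N ≤ (T^[n + 1] x).1 →
          (T^[n + 1] x).1 ≤ c + d₂ N → ∃ s i, n + 1 = i + s ∧
          ((T^[s] x ∈ {q | q ∈ S ∧ c - d₁ N ≤ q.1 ∧ q.1 < c} ∧ i < k N) ∨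
            (T^[s] x ∈ {q | q ∈ S ∧ c < q.1 ∧ q.1 ≤ c + d₂ N} ∧ i < l N)) := by
        intro hS ha hb
        refine ⟨n + 1, 0, by simp, ?_⟩
        rcases lt_or_gt_of_ne (hc _ hS) with hlt | hgt
        · exact Or.inl ⟨⟨hS, ha, hlt⟩, (h N).time_left_pos⟩
        · exact Or.inr ⟨⟨hS, hgt, hb⟩, (h N).time_right_pos⟩
      obtain ⟨s, i, rfl, ⟨hA, hi⟩ | ⟨hA, hi⟩⟩ := ih
      · by_cases hik : i + 1 < k N
        · exact ⟨s, i + 1, by omega, Or.inl ⟨hA, hik⟩⟩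
        · obtain ⟨hS, ha, hb⟩ := hA
          obtain ⟨hS', e⟩ := (h N).left_return _ hS ha hb
          have e1 : i + s + 1 = k N + s := by omega
          rw [e1, Function.iterate_add_apply] at restart
          rw [e1]
          refine restart hS' ?_ ?_ <;> rw [e] <;> nlinarith
      · by_cases hik : i + 1 < l N
        · exact ⟨s, i + 1, by omega, Or.inr ⟨hA, hik⟩⟩
        · obtain ⟨hS, ha, hb⟩ := hA
          obtain ⟨hS', e⟩ := (h N).right_return _ hS ha hb
          have e1 : i + s + 1 = l N + s := by omega
          rw [e1, Function.iterate_add_apply] at restart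
          rw [e1]
          refine restart hS' ?_ ?_ <;> rw [e] <;> nlinarith

/-! ### The alternative for the induction, and parameters for which it is infinite. -/

/-- One step of the induction on intervals: `c - d₁ < c < c + d₂` with return times `k, l`. -/
noncomputable def inductionStep (lam : ℝ) (s : (ℝ × ℝ) × ℕ × ℕ) : (ℝ × ℝ) × ℕ × ℕ :=
  if s.1.1 < lam ^ s.2.2 * s.1.2 then
    ((s.1.1, lam ^ s.2.2 * s.1.2 - s.1.1), (s.2.2 + s.2.1, s.2.2))
  -- This branch is meaningful only if the left induction applies, which holds as long as the
  -- induction has not ended.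
  else ((lam ^ s.2.1 * s.1.1 - s.1.2, s.1.2), (s.2.1, s.2.1 + s.2.2))

lemma exists_lt_of_geometric {lam : ℝ} (h0 : 0 < lam) (h1 : lam < 1) {d₁ d₂ : ℕ → ℝ}
    (hp : ∀ n, 0 < d₁ n ∧ 0 < d₂ n)
    (h : ∀ n, d₁ (n + 1) + d₂ (n + 1) ≤ lam * (d₁ n + d₂ n)) {δ : ℝ} (hδ : 0 < δ) :
    ∃ n, d₁ n < δ ∧ d₂ n < δ := by
  have key : ∀ n, d₁ n + d₂ n ≤ lam ^ n * (d₁ 0 + d₂ 0) := by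
    intro n
    induction n with
    | zero => simp
    | succ n ih =>
      calc _ ≤ _ := h n
        _ ≤ lam * (lam ^ n * (d₁ 0 + d₂ 0)) := mul_le_mul_of_nonneg_left ih h0.le
        _ = _ := by ring
  have hD : 0 < d₁ 0 + d₂ 0 := add_pos (hp 0).1 (hp 0).2
  obtain ⟨n, hn⟩ := exists_pow_lt_of_lt_one (div_pos hδ hD) h1
  rw [lt_div_iff₀ hD] at hn
  have := key n
  have := hp n
  exact ⟨n, by linarith, by linarith⟩

/-- Either the induction ends, or it gives arbitrarily short intervals around `c`. -/
lemma IsRenormInterval.terminal_or_infinite {T : ℝ × ℝ → ℝ × ℝ} {S : Set (ℝ × ℝ)}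
    {lam c e₁ e₂ : ℝ} {i j : ℕ} (h0 : 0 < lam) (h1 : lam < 1)
    (h : IsRenormInterval T S lam c e₁ e₂ i j) :
    (∃ d₁ d₂ k l, IsRenormInterval T S lam c d₁ d₂ k l ∧ lam ^ l * d₂ ≤ d₁ ∧ lam ^ k * d₁ ≤ d₂) ∨
    ∃ (d₁ d₂ : ℕ → ℝ) (k l : ℕ → ℕ),
      (∀ n, IsRenormInterval T S lam c (d₁ n) (d₂ n) (k n) (l n)) ∧
      ∀ δ > 0, ∃ n, d₁ n < δ ∧ d₂ n < δ := by
  by_cases hterm : ∃ d₁ d₂ k l, IsRenormInterval T S lam c d₁ d₂ k l ∧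
      lam ^ l * d₂ ≤ d₁ ∧ lam ^ k * d₁ ≤ d₂
  · exact Or.inl hterm
  refine Or.inr ?_
  set st : ℕ → (ℝ × ℝ) × ℕ × ℕ := fun n => (inductionStep lam)^[n] ((e₁, e₂), (i, j)) with hst
  have hsucc : ∀ n, st (n + 1) = inductionStep lam (st n) := fun n =>
    Function.iterate_succ_apply' _ _ _
  have hpow : ∀ m : ℕ, 0 < m → lam ^ m ≤ lam := fun m hm => by
    simpa using pow_le_pow_of_le_one h0.le h1.le hm
  have hR : ∀ n, IsRenormInterval T S lam c (st n).1.1 (st n).1.2 (st n).2.1 (st n).2.2 := by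
    intro n
    induction n with
    | zero => exact h
    | succ n ih =>
      rw [hsucc]
      unfold inductionStep
      split_ifs with hlt
      · exact ih.induce_right h0 h1 hlt
      · refine ih.induce_left h0 h1 ?_
        by_contra hge
        exact hterm ⟨_, _, _, _, ih, not_lt.1 hlt, not_lt.1 hge⟩
  refine ⟨fun n => (st n).1.1, fun n => (st n).1.2, fun n => (st n).2.1, fun n => (st n).2.2, hR,
    fun δ hδ => exists_lt_of_geometric h0 h1 (fun n => ⟨(hR n).left_pos, (hR n).right_pos⟩)
      (fun n => ?_) hδ⟩
  have p₁ := (hR n).left_pos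
  have p₂ := (hR n).right_pos
  have q₁ := hpow _ (hR n).time_left_pos
  have q₂ := hpow _ (hR n).time_right_pos
  simp only [hsucc, inductionStep]
  split_ifs with hlt
  · simp only; nlinarith
  · simp only; nlinarith

/-- The parameters `c` for which the induction goes alternately to the right and to the left for a
given number of steps: those between `lo` and `hi`, with `d₁ = A * (c - lo)`, `d₂ = B * (hi - c)`. -/
structure ParameterInterval where
  A : ℝ
  B : ℝ
  lo : ℝ
  hi : ℝ
  k : ℕ
  l : ℕ

namespace ParameterInterval

/-- The new `d₂` is affine in `c`, namely `lam ^ l * B * (hi - c) - A * (c - lo)`. Its zero, a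
weighted mean of the old ends, is the new `hi`, and its slope gives the new `B`. -/
noncomputable def right (lam : ℝ) (s : ParameterInterval) : ParameterInterval where
  A := s.A
  B := lam ^ s.l * s.B + s.A
  lo := s.lo
  hi := (lam ^ s.l * s.B * s.hi + s.A * s.lo) / (lam ^ s.l * s.B + s.A)
  k := s.l + s.k
  l := s.l

noncomputable def left (lam : ℝ) (s : ParameterInterval) : ParameterInterval where
  A := lam ^ s.k * s.A + s.B
  B := s.B
  lo := (lam ^ s.k * s.A * s.lo + s.B * s.hi) / (lam ^ s.k * s.A + s.B)
  hi := s.hi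
  k := s.k
  l := s.k + s.l

/-- The interval is not degenerate. -/
def Valid (s : ParameterInterval) : Prop := 0 < s.A ∧ 0 < s.B ∧ s.lo < s.hi

variable {lam : ℝ} {s : ParameterInterval}

lemma right_spec (h0 : 0 < lam) (h : s.Valid) :
    (s.right lam).Valid ∧ (s.right lam).hi < s.hi ∧
      ∀ c, (s.right lam).B * ((s.right lam).hi - c) =
        lam ^ s.l * (s.B * (s.hi - c)) - s.A * (c - s.lo) := by
  obtain ⟨hA, hB, hlt⟩ := h
  have hp : 0 < lam ^ s.l * s.B := by positivity
  have hpos : 0 < lam ^ s.l * s.B + s.A := by positivity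
  refine ⟨⟨hA, hpos, ?_⟩, ?_, fun c => ?_⟩
  · simp only [right]
    rw [lt_div_iff₀ hpos]; nlinarith
  · simp only [right]
    rw [div_lt_iff₀ hpos]; nlinarith
  · simp only [right]
    rw [mul_sub, mul_div_cancel₀ _ hpos.ne']; ring

lemma left_spec (h0 : 0 < lam) (h : s.Valid) :
    (s.left lam).Valid ∧ s.lo < (s.left lam).lo ∧
      ∀ c, (s.left lam).A * (c - (s.left lam).lo) =
        lam ^ s.k * (s.A * (c - s.lo)) - s.B * (s.hi - c) := by
  obtain ⟨hA, hB, hlt⟩ := h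
  have hp : 0 < lam ^ s.k * s.A := by positivity
  have hpos : 0 < lam ^ s.k * s.A + s.B := by positivity
  refine ⟨⟨hpos, hB, ?_⟩, ?_, fun c => ?_⟩
  · simp only [left]
    rw [div_lt_iff₀ hpos]; nlinarith
  · simp only [left]
    rw [lt_div_iff₀ hpos]; nlinarith
  · simp only [left]
    rw [mul_sub, mul_div_cancel₀ _ hpos.ne']; ring

end ParameterInterval

open ParameterInterval in
/-- There is a position of `c` in `[p, r]` for which the induction never ends. -/
lemma exists_alternating {lam p r : ℝ} (h0 : 0 < lam) (hpr : p < r) (k₀ l₀ : ℕ) :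
    ∃ (c : ℝ) (d₁ d₂ : ℕ → ℝ) (k l : ℕ → ℕ), d₁ 0 = c - p ∧ d₂ 0 = r - c ∧ k 0 = k₀ ∧ l 0 = l₀ ∧
      ∀ n, 0 < d₁ n ∧ 0 < d₂ n ∧ d₁ n < lam ^ l n * d₂ n ∧
        d₂ (n + 1) = lam ^ l n * d₂ n - d₁ n ∧ k (n + 1) = l n + k n ∧
        d₂ (n + 1) < lam ^ k (n + 1) * d₁ n ∧
        d₁ (n + 1) = lam ^ k (n + 1) * d₁ n - d₂ (n + 1) ∧ l (n + 1) = k (n + 1) + l n := by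
  set st : ℕ → ParameterInterval := fun n =>
    (fun s => (s.right lam).left lam)^[n] ⟨1, 1, p, r, k₀, l₀⟩ with hst
  have hsucc : ∀ n, st (n + 1) = ((st n).right lam).left lam := fun n =>
    Function.iterate_succ_apply' _ _ _
  have hV : ∀ n, (st n).Valid := by
    intro n
    induction n with
    | zero => exact ⟨one_pos, one_pos, hpr⟩
    | succ n ih => rw [hsucc]; exact (left_spec h0 (right_spec h0 ih).1).1
  have hlo : ∀ n, (st n).lo < (st (n + 1)).lo := fun n => by
    rw [hsucc]; exact (left_spec h0 (right_spec h0 (hV n)).1).2.1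
  have hhi : ∀ n, (st (n + 1)).hi < (st n).hi := fun n => by
    rw [hsucc]; exact (right_spec h0 (hV n)).2.1
  have hlom : StrictMono fun n => (st n).lo := strictMono_nat_of_lt_succ hlo
  have hhim : StrictAnti fun n => (st n).hi := strictAnti_nat_of_succ_lt hhi
  have hcross : ∀ m n, (st m).lo ≤ (st n).hi := fun m n => by
    have a := hlom.monotone (le_max_left m n)
    have b := hhim.antitone (le_max_right m n)
    exact a.trans ((hV _).2.2.le.trans b)
  have hbdd : BddAbove (range fun n => (st n).lo) := ⟨(st 0).hi, by
    rintro _ ⟨m, rfl⟩; exact hcross m 0⟩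
  -- Both ends move strictly at each double step, so this supremum is strictly inside every
  -- parameter interval.
  set c := ⨆ n, (st n).lo with hc
  have hcl : ∀ n, (st n).lo < c := fun n => (hlo n).trans_le (le_ciSup hbdd (n + 1))
  have hch : ∀ n, c < (st n).hi := fun n =>
    (ciSup_le fun m => hcross m (n + 1)).trans_lt (hhi n)
  refine ⟨c, fun n => (st n).A * (c - (st n).lo), fun n => (st n).B * ((st n).hi - c),
    fun n => (st n).k, fun n => (st n).l, by simp [hst], by simp [hst], rfl, rfl, fun n => ?_⟩
  have e₁ := (right_spec h0 (hV n)).2.2 c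
  have e₂ := (left_spec h0 (right_spec h0 (hV n)).1).2.2 c
  have v := hV (n + 1)
  have l₁ := hcl (n + 1)
  have l₂ := hch (n + 1)
  have w₁ : 0 < (st (n + 1)).A * (c - (st (n + 1)).lo) := mul_pos v.1 (sub_pos.2 l₁)
  have w₂ : 0 < (st (n + 1)).B * ((st (n + 1)).hi - c) := mul_pos v.2.1 (sub_pos.2 l₂)
  have eB : (st (n + 1)).B * ((st (n + 1)).hi - c) =
      ((st n).right lam).B * (((st n).right lam).hi - c) := by rw [hsucc]; rfl
  have ek : (st (n + 1)).k = ((st n).right lam).k := by rw [hsucc]; rfl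
  have eA : (st (n + 1)).A * (c - (st (n + 1)).lo) = lam ^ (st (n + 1)).k *
      ((st n).A * (c - (st n).lo)) - (st (n + 1)).B * ((st (n + 1)).hi - c) := by
    rw [eB, ek, hsucc, e₂]; rfl
  refine ⟨mul_pos (hV n).1 (sub_pos.2 (hcl n)), mul_pos (hV n).2.1 (sub_pos.2 (hch n)), ?_, ?_, ?_,
    ?_, eA, ?_⟩
  · rw [eB, e₁] at w₂; linarith
  · simp only [eB, e₁]
  · exact ek
  · rw [eA] at w₁; linarith
  · change (st (n + 1)).l = (st (n + 1)).k + (st n).l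
    rw [hsucc]; rfl

lemma IsRenormInterval.infinite_of_alternating {T : ℝ × ℝ → ℝ × ℝ} {S : Set (ℝ × ℝ)}
    {lam c : ℝ} (h0 : 0 < lam) (h1 : lam < 1) {d₁ d₂ : ℕ → ℝ} {k l : ℕ → ℕ}
    (h : IsRenormInterval T S lam c (d₁ 0) (d₂ 0) (k 0) (l 0))
    (hd : ∀ n, 0 < d₁ n ∧ 0 < d₂ n ∧ d₁ n < lam ^ l n * d₂ n ∧
        d₂ (n + 1) = lam ^ l n * d₂ n - d₁ n ∧ k (n + 1) = l n + k n ∧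
        d₂ (n + 1) < lam ^ k (n + 1) * d₁ n ∧
        d₁ (n + 1) = lam ^ k (n + 1) * d₁ n - d₂ (n + 1) ∧ l (n + 1) = k (n + 1) + l n) :
    (∀ n, IsRenormInterval T S lam c (d₁ n) (d₂ n) (k n) (l n)) ∧
      ∀ δ > 0, ∃ n, d₁ n < δ ∧ d₂ n < δ := by
  have hR : ∀ n, IsRenormInterval T S lam c (d₁ n) (d₂ n) (k n) (l n) := by
    intro n
    induction n with
    | zero => exact h
    | succ n ih =>
      obtain ⟨-, -, r₁, r₂, r₃, r₄, r₅, r₆⟩ := hd n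
      have := ih.induce_right h0 h1 r₁
      rw [← r₂, ← r₃] at this
      have := this.induce_left h0 h1 r₄
      rwa [← r₅, ← r₆] at this
  refine ⟨hR, fun δ hδ => exists_lt_of_geometric h0 h1 (fun n => ⟨(hd n).1, (hd n).2.1⟩)
    (fun n => ?_) hδ⟩
  obtain ⟨p₁, p₂, -, -, -, -, r₅, -⟩ := hd n
  have : lam ^ k (n + 1) ≤ lam := by
    simpa using pow_le_pow_of_le_one h0.le h1.le (hR (n + 1)).time_left_pos
  rw [r₅]; nlinarith

/-! ### Tangent vertices and regular points. -/

lemma convexHull_subset_halfPlane {V : Set (ℝ × ℝ)} {α β γ : ℝ}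
    (h : ∀ w ∈ V, γ ≤ α * w.1 + β * w.2) :
    ∀ w ∈ convexHull ℝ V, γ ≤ α * w.1 + β * w.2 := by
  have hconv : Convex ℝ {w : ℝ × ℝ | γ ≤ α * w.1 + β * w.2} := by
    intro p hp q hq s t hs ht hst
    simp only [mem_ofPred_eq, Prod.fst_add, Prod.snd_add, Prod.smul_fst, Prod.smul_snd,
      smul_eq_mul] at *
    have e : γ = s * γ + t * γ := by rw [← add_mul, hst, one_mul]
    rw [e]
    have := mul_le_mul_of_nonneg_left hp hs
    have := mul_le_mul_of_nonneg_left hq ht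
    linarith
  exact fun w hw => convexHull_min (fun w hw => h w hw) hconv hw

lemma isLeftTangentVertex_iff {V : Set (ℝ × ℝ)} {x v : ℝ × ℝ} :
    IsLeftTangentVertex V x v ↔ v ∈ V ∧ ∀ w ∈ V, 0 ≤ cross (v - x) (w - x) := by
  refine and_congr_right fun _ => ⟨fun h w hw => h w (subset_convexHull ℝ V hw), fun h w hw => ?_⟩
  have := convexHull_subset_halfPlane (V := V) (α := -(v - x).2) (β := (v - x).1)
    (γ := (v - x).1 * x.2 - (v - x).2 * x.1) (fun w hw => by
      have := h w hw
      simp only [cross, Prod.fst_sub, Prod.snd_sub] at this ⊢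
      linarith) w hw
  simp only [cross, Prod.fst_sub, Prod.snd_sub] at this ⊢
  linarith

/-- Uniqueness of the tangent vertex makes the inequality strict. If `w - x = s • (v - x)`, then for
`s ≤ 0` the point `x` is on the segment from `w` to `v`, inside the polygon, and for `s > 0` also
`w` is a tangent vertex. -/
lemma cross_pos_of_mem_regularPoints {V : Set (ℝ × ℝ)} {x v w : ℝ × ℝ} (hx : x ∈ regularPoints V)
    (hv : IsLeftTangentVertex V x v) (hw : w ∈ V) (hne : w ≠ v) :
    0 < cross (v - x) (w - x) := by
  obtain ⟨hhull, hu⟩ := hx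
  have hcv := convex_convexHull ℝ V
  rw [isLeftTangentVertex_iff] at hv
  refine lt_of_le_of_ne (hv.2 w hw) fun h0 => ?_
  obtain ⟨u₁, hu₁⟩ : ∃ u₁, u₁ = v.1 - x.1 := ⟨_, rfl⟩
  obtain ⟨u₂, hu₂⟩ : ∃ u₂, u₂ = v.2 - x.2 := ⟨_, rfl⟩
  simp only [cross, Prod.fst_sub, Prod.snd_sub, ← hu₁, ← hu₂] at h0
  have hpos : 0 < u₁ ^ 2 + u₂ ^ 2 := by
    by_contra hle
    have h1 : u₁ = 0 := by nlinarith [sq_nonneg u₁, sq_nonneg u₂]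
    have h2 : u₂ = 0 := by nlinarith [sq_nonneg u₁, sq_nonneg u₂]
    have : x = v := Prod.ext (by linarith) (by linarith)
    exact hhull (this ▸ subset_convexHull ℝ V hv.1)
  obtain ⟨s, hs⟩ : ∃ s, s = (u₁ * (w.1 - x.1) + u₂ * (w.2 - x.2)) / (u₁ ^ 2 + u₂ ^ 2) := ⟨_, rfl⟩
  have e1 : w.1 - x.1 = s * u₁ := by
    rw [hs]; field_simp; linear_combination u₂ * h0
  have e2 : w.2 - x.2 = s * u₂ := by
    rw [hs]; field_simp; linear_combination (-u₁) * h0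
  rcases le_or_gt s 0 with hs0 | hs0
  · apply hhull
    have h1s : 0 < 1 - s := by linarith
    have : x = (1 / (1 - s)) • w + (-s / (1 - s)) • v := by
      refine Prod.ext ?_ ?_
      · simp only [Prod.fst_add, Prod.smul_fst, smul_eq_mul]
        field_simp
        rw [hu₁] at e1; linarith
      · simp only [Prod.snd_add, Prod.smul_snd, smul_eq_mul]
        field_simp
        rw [hu₂] at e2; linarith
    rw [this]
    refine hcv (subset_convexHull ℝ V hw) (subset_convexHull ℝ V hv.1) (by positivity)
      (div_nonneg (by linarith) h1s.le) ?_
    field_simp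
    ring
  · refine hne (hu.unique (isLeftTangentVertex_iff.2 ⟨hw, fun z hz => ?_⟩)
      (isLeftTangentVertex_iff.2 hv))
    have hz' := hv.2 z hz
    simp only [cross, Prod.fst_sub, Prod.snd_sub, ← hu₁, ← hu₂] at hz' ⊢
    rw [e1, e2]
    nlinarith

lemma outerBilliard_spec {V : Set (ℝ × ℝ)} (lam : ℝ) {x : ℝ × ℝ} (hx : x ∈ regularPoints V) :
    ∃ v ∈ V, outerBilliard V lam x = v + lam • (v - x) ∧
      ∀ w ∈ V, w ≠ v → 0 < cross (v - x) (w - x) := by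
  have hv := hx.2.choose_spec.1
  exact ⟨hx.2.choose, hv.1, by rw [outerBilliard, dif_pos hx],
    fun w hw hne => cross_pos_of_mem_regularPoints hx hv hw hne⟩

lemma mem_regularPoints_of_cross_pos {V : Set (ℝ × ℝ)} {x v : ℝ × ℝ} (hv : v ∈ V)
    (hx : x ∉ convexHull ℝ V) (h : ∀ w ∈ V, w ≠ v → 0 < cross (v - x) (w - x)) :
    x ∈ regularPoints V := by
  refine ⟨hx, v, isLeftTangentVertex_iff.2 ⟨hv, fun w hw => ?_⟩, fun w hw => ?_⟩
  · by_cases hwv : w = v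
    · subst hwv
      simp only [cross]; linarith
    · exact (h w hw hwv).le
  · by_contra hne
    have hw := isLeftTangentVertex_iff.1 hw
    have h1 := h w hw.1 hne
    have h2 := hw.2 v hv
    simp only [cross] at h1 h2
    linarith

/-! ### The four branches of the map at the quadrilateral. -/

/-- The outer billiard map at the quadrilateral with `b = 0.4`, with contraction `0.6`. -/
noncomputable abbrev quadMap (a : ℝ) : ℝ × ℝ → ℝ × ℝ := outerBilliard (quadVertices a 0.4) 0.6

/-- The open regions in which the tangent vertex is `A`, `B`, `C`, `D`. -/
def regionA : Set (ℝ × ℝ) := {q | 0 < q.1 ∧ 1 < q.2}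

def regionB (a : ℝ) : Set (ℝ × ℝ) :=
  {q | q.2 < 1 ∧ 0.6 + 0.4 * (1 - a) < 0.6 * q.1 + (1 - a) * q.2}

def regionC (a : ℝ) : Set (ℝ × ℝ) :=
  {q | q.2 < 0.4 * q.1 ∧ 0.6 * q.1 + (1 - a) * q.2 < 0.6 + 0.4 * (1 - a)}

def regionD : Set (ℝ × ℝ) := {q | q.1 < 0 ∧ 0.4 * q.1 < q.2}

section quadrilateral

variable {a : ℝ} {q : ℝ × ℝ}

/-- Each domain is the wedge cut out by the lines of the two sides at its vertex, so only the two
neighbouring vertices are tested. -/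
lemma quadMap_cases (ha : 0.4 ≤ a)
    (hq : q ∈ regularPoints (quadVertices a 0.4)) :
    (q ∈ regionA ∧ quadMap a q = (-0.6 * q.1, 1.6 - 0.6 * q.2)) ∨
    (q ∈ regionB a ∧ quadMap a q = (1.6 * a - 0.6 * q.1, 1.6 - 0.6 * q.2)) ∨
    (q ∈ regionC a ∧ quadMap a q = (1.6 - 0.6 * q.1, 0.64 - 0.6 * q.2)) ∨
    (q ∈ regionD ∧ quadMap a q = (-0.6 * q.1, -0.6 * q.2)) := by
  norm_num at ha
  obtain ⟨v, hv, e, h⟩ := outerBilliard_spec (0.6 : ℝ) hq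
  have hA := h (0, 1) (by simp [quadVertices])
  have hB := h (a, 1) (by simp [quadVertices])
  have hC := h (1, 0.4) (by simp [quadVertices])
  have hD := h (0, 0) (by simp [quadVertices])
  simp only [quadVertices, mem_insert_iff, mem_singleton_iff] at hv
  rcases hv with rfl | rfl | rfl | rfl
  · have h1 := hB (fun h => by have := congrArg Prod.fst h; simp only at this; linarith)
    have h2 := hD (fun h => by have := congrArg Prod.snd h; norm_num at this)
    simp only [cross, Prod.fst_sub, Prod.snd_sub] at h1 h2
    refine Or.inl ⟨⟨by linarith, ?_⟩, ?_⟩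
    · have : 0 < a * (q.2 - 1) := by linarith
      have := (pos_iff_pos_of_mul_pos this).1 (by linarith)
      linarith
    · rw [quadMap, e]
      refine Prod.ext ?_ ?_
      · simp
      · simp; ring
  · have h1 := hA (fun h => by have := congrArg Prod.fst h; simp only at this; linarith)
    have h2 := hC (fun h => by have := congrArg Prod.snd h; norm_num at this)
    simp only [cross, Prod.fst_sub, Prod.snd_sub] at h1 h2
    refine Or.inr (Or.inl ⟨⟨?_, by linarith⟩, ?_⟩)
    · have : 0 < a * (1 - q.2) := by linarith
      have := (pos_iff_pos_of_mul_pos this).1 (by linarith)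
      linarith
    · rw [quadMap, e]
      refine Prod.ext ?_ ?_ <;> simp <;> ring
  · have h1 := hB (fun h => by have := congrArg Prod.snd h; norm_num at this)
    have h2 := hD (fun h => by have := congrArg Prod.snd h; norm_num at this)
    simp only [cross, Prod.fst_sub, Prod.snd_sub] at h1 h2
    refine Or.inr (Or.inr (Or.inl ⟨⟨by linarith, by linarith⟩, ?_⟩))
    rw [quadMap, e]
    refine Prod.ext ?_ ?_ <;> simp <;> ring
  · have h1 := hA (fun h => by have := congrArg Prod.snd h; norm_num at this)
    have h2 := hC (fun h => by have := congrArg Prod.snd h; norm_num at this)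
    simp only [cross, Prod.fst_sub, Prod.snd_sub] at h1 h2
    refine Or.inr (Or.inr (Or.inr ⟨⟨by linarith, by linarith⟩, ?_⟩))
    rw [quadMap, e]
    refine Prod.ext ?_ ?_ <;> simp

/-- Applied below with the line of a side at the tangent vertex as separating line. -/
lemma notMem_quad_of_halfPlane {α β γ : ℝ} (hA : γ ≤ β) (hB : γ ≤ α * a + β)
    (hC : γ ≤ α + β * 0.4) (hD : γ ≤ 0) (hq : α * q.1 + β * q.2 < γ) :
    q ∉ convexHull ℝ (quadVertices a 0.4) := by
  intro hmem
  refine absurd (convexHull_subset_halfPlane (α := α) (β := β) (γ := γ) ?_ q hmem) (not_le.2 hq)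
  intro w hw
  simp only [quadVertices, mem_insert_iff, mem_singleton_iff] at hw
  rcases hw with rfl | rfl | rfl | rfl <;> simp only <;> linarith

lemma regular_of_mem_regionA (ha : 0.4 ≤ a) (hq : q ∈ regionA) :
    q ∈ regularPoints (quadVertices a 0.4) := by
  norm_num at ha
  obtain ⟨h1, h2⟩ := hq
  refine mem_regularPoints_of_cross_pos (v := (0, 1)) (by simp [quadVertices])
    (notMem_quad_of_halfPlane (α := 0) (β := -1) (γ := -1) (by norm_num) (by norm_num)
      (by norm_num) (by norm_num) (by linarith)) ?_
  intro w hw hne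
  simp only [quadVertices, mem_insert_iff, mem_singleton_iff] at hw
  rcases hw with rfl | rfl | rfl | rfl
  · exact absurd rfl hne
  all_goals simp only [cross, Prod.fst_sub, Prod.snd_sub]; nlinarith

lemma regular_of_mem_regionB (ha : 0.4 ≤ a) (ha' : a ≤ 0.5) (hq : q ∈ regionB a) :
    q ∈ regularPoints (quadVertices a 0.4) := by
  norm_num at ha ha'
  obtain ⟨h1, h2⟩ := hq
  refine mem_regularPoints_of_cross_pos (v := (a, 1)) (by simp [quadVertices])
    (notMem_quad_of_halfPlane (α := -0.6) (β := -(1 - a)) (γ := -(0.6 + 0.4 * (1 - a)))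
      (by linarith) (by linarith) (by linarith) (by linarith) (by linarith)) ?_
  intro w hw hne
  simp only [quadVertices, mem_insert_iff, mem_singleton_iff] at hw
  rcases hw with rfl | rfl | rfl | rfl
  · simp only [cross, Prod.fst_sub, Prod.snd_sub]; nlinarith
  · exact absurd rfl hne
  · simp only [cross, Prod.fst_sub, Prod.snd_sub]; nlinarith
  · simp only [cross, Prod.fst_sub, Prod.snd_sub]
    nlinarith [mul_pos (by linarith : (0 : ℝ) < 1 - 0.4 * a) (sub_pos.2 h1)]

lemma regular_of_mem_regionC (ha : 0.4 ≤ a) (ha' : a ≤ 0.5) (hq : q ∈ regionC a) :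
    q ∈ regularPoints (quadVertices a 0.4) := by
  norm_num at ha ha'
  obtain ⟨h1, h2⟩ := hq
  refine mem_regularPoints_of_cross_pos (v := (1, 0.4)) (by simp [quadVertices])
    (notMem_quad_of_halfPlane (α := -0.4) (β := 1) (γ := 0)
      (by linarith) (by linarith) (by linarith) (by linarith) (by linarith)) ?_
  intro w hw hne
  simp only [quadVertices, mem_insert_iff, mem_singleton_iff] at hw
  rcases hw with rfl | rfl | rfl | rfl
  · simp only [cross, Prod.fst_sub, Prod.snd_sub]; nlinarith
  · simp only [cross, Prod.fst_sub, Prod.snd_sub]; nlinarith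
  · exact absurd rfl hne
  · simp only [cross, Prod.fst_sub, Prod.snd_sub]; nlinarith

lemma regular_of_mem_regionD (ha : 0.4 ≤ a) (ha' : a ≤ 0.5) (hq : q ∈ regionD) :
    q ∈ regularPoints (quadVertices a 0.4) := by
  norm_num at ha ha'
  obtain ⟨h1, h2⟩ := hq
  refine mem_regularPoints_of_cross_pos (v := (0, 0)) (by simp [quadVertices])
    (notMem_quad_of_halfPlane (α := 1) (β := 0) (γ := 0)
      (by linarith) (by linarith) (by linarith) (by linarith) (by linarith)) ?_
  intro w hw hne
  simp only [quadVertices, mem_insert_iff, mem_singleton_iff] at hw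
  rcases hw with rfl | rfl | rfl | rfl
  · simp only [cross, Prod.fst_sub, Prod.snd_sub]; nlinarith
  · simp only [cross, Prod.fst_sub, Prod.snd_sub]; nlinarith
  · simp only [cross, Prod.fst_sub, Prod.snd_sub]; nlinarith
  · exact absurd rfl hne

/-- The four wedges are pairwise disjoint, so `quadMap_cases` leaves a single branch; likewise for
the other vertices. -/
lemma quadMap_of_mem_regionA (ha : 0.4 ≤ a) (ha' : a ≤ 0.5) (hq : q ∈ regionA) :
    quadMap a q = (-0.6 * q.1, 1.6 - 0.6 * q.2) := by
  rcases quadMap_cases ha (regular_of_mem_regionA ha hq) with h | h | h | h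
  · exact h.2
  all_goals
    norm_num at ha ha'
    have h1 := hq.1
    have h2 := hq.2
    have h3 := h.1.1
    have h4 := h.1.2
    exfalso
    nlinarith

lemma quadMap_of_mem_regionB (ha : 0.4 ≤ a) (ha' : a ≤ 0.5) (hq : q ∈ regionB a) :
    quadMap a q = (1.6 * a - 0.6 * q.1, 1.6 - 0.6 * q.2) := by
  rcases quadMap_cases ha (regular_of_mem_regionB ha ha' hq) with h | h | h | h
  rotate_left
  · exact h.2
  all_goals
    norm_num at ha ha'
    have h1 := hq.1
    have h2 := hq.2
    have h3 := h.1.1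
    have h4 := h.1.2
    exfalso
    nlinarith

lemma quadMap_of_mem_regionC (ha : 0.4 ≤ a) (ha' : a ≤ 0.5) (hq : q ∈ regionC a) :
    quadMap a q = (1.6 - 0.6 * q.1, 0.64 - 0.6 * q.2) := by
  rcases quadMap_cases ha (regular_of_mem_regionC ha ha' hq) with h | h | h | h
  rotate_left 2
  · exact h.2
  all_goals
    norm_num at ha ha'
    have h1 := hq.1
    have h2 := hq.2
    have h3 := h.1.1
    have h4 := h.1.2
    exfalso
    nlinarith

lemma quadMap_of_mem_regionD (ha : 0.4 ≤ a) (ha' : a ≤ 0.5) (hq : q ∈ regionD) :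
    quadMap a q = (-0.6 * q.1, -0.6 * q.2) := by
  rcases quadMap_cases ha (regular_of_mem_regionD ha ha' hq) with h | h | h | h
  rotate_left 3
  · exact h.2
  all_goals
    norm_num at ha ha'
    have h1 := hq.1
    have h2 := hq.2
    have h3 := h.1.1
    have h4 := h.1.2
    exfalso
    nlinarith

end quadrilateral

/-! ### The absorbing box and the first return to the section. -/

/-- A square that absorbs all orbits. -/
def trappingBox : Set (ℝ × ℝ) := {q | |q.1 - 0.5| ≤ 2.05 ∧ |q.2 - 0.5| ≤ 2.05}

lemma isCompact_trappingBox : IsCompact trappingBox := by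
  have : trappingBox = Metric.closedBall ((0.5, 0.5) : ℝ × ℝ) 2.05 := by
    ext q
    simp only [trappingBox, Metric.mem_closedBall, Prod.dist_eq, Real.dist_eq, max_le_iff]
    rfl
  rw [this]
  exact isCompact_closedBall _ _

/-- The fully regular points in the absorbing square. -/
def trapped (a : ℝ) : Set (ℝ × ℝ) := fullyRegular (quadVertices a 0.4) 0.6 ∩ trappingBox

/-- The section: the trapped points of the region with tangent vertex `B`. -/
def quadSection (a : ℝ) : Set (ℝ × ℝ) := trapped a ∩ regionB a

section trapping

variable {a : ℝ} {q : ℝ × ℝ}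

lemma fullyRegular_iterate (hq : q ∈ fullyRegular (quadVertices a 0.4) 0.6) (n : ℕ) :
    (quadMap a)^[n] q ∈ fullyRegular (quadVertices a 0.4) 0.6 := by
  intro m
  rw [← Function.iterate_add_apply]
  exact hq (m + n)

/-- The vertices are within 0.5 of the centre in each coordinate, and 0.8 = 1.6 * 0.5. The fixed
point of r ↦ 0.8 + 0.6 r is 2, so the radius 2.05 of `trappingBox` is reached in finite time and is
preserved. -/
lemma abs_quadMap_le (ha : 0.4 ≤ a) (ha' : a ≤ 0.5)
    (hq : q ∈ regularPoints (quadVertices a 0.4)) :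
    |(quadMap a q).1 - 0.5| ≤ 0.8 + 0.6 * |q.1 - 0.5| ∧
      |(quadMap a q).2 - 0.5| ≤ 0.8 + 0.6 * |q.2 - 0.5| := by
  norm_num at ha ha'
  have h1 := neg_abs_le (q.1 - 0.5)
  have h2 := le_abs_self (q.1 - 0.5)
  have h3 := neg_abs_le (q.2 - 0.5)
  have h4 := le_abs_self (q.2 - 0.5)
  rcases quadMap_cases (by norm_num; exact ha) hq with h | h | h | h <;> rw [h.2] <;>
    simp only [abs_le] <;> norm_num at * <;> refine ⟨⟨?_, ?_⟩, ?_, ?_⟩ <;> linarith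

lemma mapsTo_trapped (ha : 0.4 ≤ a) (ha' : a ≤ 0.5) (hq : q ∈ trapped a) :
    quadMap a q ∈ trapped a := by
  obtain ⟨hX, h1, h2⟩ := hq
  obtain ⟨h3, h4⟩ := abs_quadMap_le ha ha' (hX 0)
  refine ⟨fullyRegular_iterate hX 1, ?_, ?_⟩
  · norm_num at *; linarith
  · norm_num at *; linarith

lemma iterate_mem_trapped (ha : 0.4 ≤ a) (ha' : a ≤ 0.5) (hq : q ∈ trapped a) (n : ℕ) :
    (quadMap a)^[n] q ∈ trapped a := by
  induction n with
  | zero => exact hq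
  | succ n ih => rw [Function.iterate_succ_apply']; exact mapsTo_trapped ha ha' ih

lemma exists_iterate_mem_trapped (ha : 0.4 ≤ a) (ha' : a ≤ 0.5)
    (hq : q ∈ fullyRegular (quadVertices a 0.4) 0.6) : ∃ n, (quadMap a)^[n] q ∈ trapped a := by
  have key : ∀ n, |((quadMap a)^[n] q).1 - 0.5| ≤ 2 + 0.6 ^ n * |q.1 - 0.5| ∧
      |((quadMap a)^[n] q).2 - 0.5| ≤ 2 + 0.6 ^ n * |q.2 - 0.5| := by
    intro n
    induction n with
    | zero => simp
    | succ n ih =>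
      obtain ⟨h1, h2⟩ := abs_quadMap_le (q := (quadMap a)^[n] q) ha ha' (hq n)
      rw [Function.iterate_succ_apply', pow_succ]
      constructor
      · linarith [ih.1]
      · linarith [ih.2]
  have hlim : ∀ D : ℝ, ∀ᶠ n : ℕ in atTop, (0.6 : ℝ) ^ n * D < 0.05 := fun D => by
    have := (tendsto_pow_atTop_nhds_zero_of_lt_one (r := (0.6 : ℝ)) (by norm_num)
      (by norm_num)).mul_const D
    rw [zero_mul] at this
    exact this.eventually_lt_const (by norm_num)
  obtain ⟨n, h1, h2⟩ := ((hlim |q.1 - 0.5|).and (hlim |q.2 - 0.5|)).exists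
  refine ⟨n, fullyRegular_iterate hq n, ?_, ?_⟩
  · have := (key n).1
    norm_num at *; linarith
  · have := (key n).2
    norm_num at *; linarith

lemma trapped_bounds (hq : q ∈ trapped a) : -1.55 ≤ q.1 ∧ q.1 ≤ 2.55 ∧ -1.55 ≤ q.2 ∧ q.2 ≤ 2.55 := by
  obtain ⟨-, h1, h2⟩ := hq
  rw [abs_le] at h1 h2
  norm_num at *
  refine ⟨?_, ?_, ?_, ?_⟩ <;> linarith

lemma trapped_region (ha : 0.4 ≤ a) (hq : q ∈ trapped a) :
    q ∈ regionA ∨ q ∈ regionB a ∨ q ∈ regionC a ∨ q ∈ regionD := by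
  rcases quadMap_cases ha (hq.1 0) with h | h | h | h
  · exact Or.inl h.1
  · exact Or.inr (Or.inl h.1)
  · exact Or.inr (Or.inr (Or.inl h.1))
  · exact Or.inr (Or.inr (Or.inr h.1))

/-- This and the next three lemmas give the possible transitions; the bounds of the box exclude the
others. -/
lemma trapped_step_A (ha : 0.4 ≤ a) (ha' : a ≤ 0.5) (hq : q ∈ trapped a) (hr : q ∈ regionA) :
    quadMap a q ∈ regionD := by
  obtain ⟨b1, b2, b3, b4⟩ := trapped_bounds hq
  obtain ⟨h1, h2⟩ := hr
  rw [quadMap_of_mem_regionA ha ha' ⟨h1, h2⟩]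
  norm_num at *
  constructor <;> norm_num <;> linarith

lemma trapped_step_D (ha : 0.4 ≤ a) (ha' : a ≤ 0.5) (hq : q ∈ trapped a) (hr : q ∈ regionD) :
    quadMap a q ∈ regionC a := by
  obtain ⟨b1, b2, b3, b4⟩ := trapped_bounds hq
  obtain ⟨h1, h2⟩ := hr
  rw [quadMap_of_mem_regionD ha ha' ⟨h1, h2⟩]
  norm_num at *
  constructor <;> norm_num <;> nlinarith

lemma trapped_step_C (ha : 0.4 ≤ a) (ha' : a ≤ 0.5) (hq : q ∈ trapped a) (hr : q ∈ regionC a) :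
    quadMap a q ∈ regionA ∨ quadMap a q ∈ regionB a := by
  obtain ⟨b1, b2, b3, b4⟩ := trapped_bounds hq
  have hm := mapsTo_trapped ha ha' hq
  have e := quadMap_of_mem_regionC ha ha' hr
  obtain ⟨h1, h2⟩ := hr
  rcases trapped_region ha hm with h | h | h | h
  · exact Or.inl h
  · exact Or.inr h
  all_goals
    exfalso
    obtain ⟨h3, h4⟩ := h
    rw [e] at h3 h4
    norm_num at *
    linarith

lemma trapped_step_B (ha : 0.4 ≤ a) (ha' : a ≤ 0.5) (hq : q ∈ trapped a) (hr : q ∈ regionB a) :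
    quadMap a q ∈ regionA ∨ quadMap a q ∈ regionD := by
  obtain ⟨b1, b2, b3, b4⟩ := trapped_bounds hq
  have hm := mapsTo_trapped ha ha' hq
  have e := quadMap_of_mem_regionB ha ha' hr
  obtain ⟨h1, h2⟩ := hr
  rcases trapped_region ha hm with h | h | h | h
  · exact Or.inl h
  · exfalso
    obtain ⟨h3, h4⟩ := h
    rw [e] at h3 h4
    norm_num at *
    linarith
  · exfalso
    obtain ⟨h3, h4⟩ := h
    rw [e] at h3 h4
    norm_num at *
    nlinarith
  · exact Or.inr h

/-- The sign of `1.6 * a - 0.6 * q.1` decides between A and D after B. After C the choice is a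
matter of parity: each step reverses the deviation of the height from its limit, and this deviation
is negative in the section. So C leads to B after an even number of steps and to A after an odd
number; the same applies in `iterate_six_of_right`. -/
lemma iterate_four_of_left (ha : 0.4 ≤ a) (ha' : a ≤ 0.5) (hq : q ∈ quadSection a)
    (hc : q.1 < 8 / 3 * a) :
    (quadMap a)^[1] q = (1.6 * a - 0.6 * q.1, 1.6 - 0.6 * q.2) ∧
    (quadMap a)^[2] q = (-0.96 * a + 0.36 * q.1, 0.64 + 0.36 * q.2) ∧
    (quadMap a)^[3] q = (0.576 * a - 0.216 * q.1, -0.384 - 0.216 * q.2) ∧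
    (quadMap a)^[4] q = (1.6 - 0.3456 * a + 0.1296 * q.1, 0.8704 + 0.1296 * q.2) ∧
    (quadMap a)^[4] q ∈ quadSection a := by
  obtain ⟨hS, hB⟩ := hq
  have t := iterate_mem_trapped ha ha' hS
  have e1 : (quadMap a)^[1] q = (1.6 * a - 0.6 * q.1, 1.6 - 0.6 * q.2) :=
    quadMap_of_mem_regionB ha ha' hB
  have r1 : (quadMap a)^[1] q ∈ regionA := by
    rcases trapped_step_B ha ha' hS hB with h | h
    · exact h
    · have h1 : ((quadMap a)^[1] q).1 < 0 := h.1
      rw [e1] at h1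
      norm_num at h1; linarith
  have e2 : (quadMap a)^[2] q = (-0.96 * a + 0.36 * q.1, 0.64 + 0.36 * q.2) := by
    rw [Function.iterate_succ_apply', quadMap_of_mem_regionA ha ha' r1, e1]
    refine Prod.ext ?_ ?_ <;> simp only <;> ring
  have r2 : (quadMap a)^[2] q ∈ regionD := by
    rw [Function.iterate_succ_apply']; exact trapped_step_A ha ha' (t 1) r1
  have e3 : (quadMap a)^[3] q = (0.576 * a - 0.216 * q.1, -0.384 - 0.216 * q.2) := by
    rw [Function.iterate_succ_apply', quadMap_of_mem_regionD ha ha' r2, e2]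
    refine Prod.ext ?_ ?_ <;> simp only <;> ring
  have r3 : (quadMap a)^[3] q ∈ regionC a := by
    rw [Function.iterate_succ_apply']; exact trapped_step_D ha ha' (t 2) r2
  have e4 : (quadMap a)^[4] q = (1.6 - 0.3456 * a + 0.1296 * q.1, 0.8704 + 0.1296 * q.2) := by
    rw [Function.iterate_succ_apply', quadMap_of_mem_regionC ha ha' r3, e3]
    refine Prod.ext ?_ ?_ <;> simp only <;> ring
  refine ⟨e1, e2, e3, e4, t 4, ?_⟩
  have h4 : (quadMap a)^[4] q ∈ regionA ∨ (quadMap a)^[4] q ∈ regionB a := by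
    rw [Function.iterate_succ_apply']; exact trapped_step_C ha ha' (t 3) r3
  refine h4.resolve_left fun h => ?_
  have h1 := h.2
  have h2 := hB.1
  rw [e4] at h1
  norm_num at h1; linarith

lemma iterate_six_of_right (ha : 0.4 ≤ a) (ha' : a ≤ 0.5) (hq : q ∈ quadSection a)
    (hc : 8 / 3 * a < q.1) :
    (quadMap a)^[1] q = (1.6 * a - 0.6 * q.1, 1.6 - 0.6 * q.2) ∧
    (quadMap a)^[2] q = (-0.96 * a + 0.36 * q.1, -0.96 + 0.36 * q.2) ∧
    (quadMap a)^[3] q = (1.6 + 0.576 * a - 0.216 * q.1, 1.216 - 0.216 * q.2) ∧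
    (quadMap a)^[4] q = (-0.96 - 0.3456 * a + 0.1296 * q.1, 0.8704 + 0.1296 * q.2) ∧
    (quadMap a)^[5] q = (0.576 + 0.20736 * a - 0.07776 * q.1, -0.52224 - 0.07776 * q.2) ∧
    (quadMap a)^[6] q = (1.2544 - 0.124416 * a + 0.046656 * q.1, 0.953344 + 0.046656 * q.2) ∧
    (quadMap a)^[6] q ∈ quadSection a := by
  obtain ⟨hS, hB⟩ := hq
  have t := iterate_mem_trapped ha ha' hS
  have e1 : (quadMap a)^[1] q = (1.6 * a - 0.6 * q.1, 1.6 - 0.6 * q.2) :=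
    quadMap_of_mem_regionB ha ha' hB
  have r1 : (quadMap a)^[1] q ∈ regionD := by
    rcases trapped_step_B ha ha' hS hB with h | h
    · have h1 : 0 < ((quadMap a)^[1] q).1 := h.1
      rw [e1] at h1
      norm_num at h1; linarith
    · exact h
  have e2 : (quadMap a)^[2] q = (-0.96 * a + 0.36 * q.1, -0.96 + 0.36 * q.2) := by
    rw [Function.iterate_succ_apply', quadMap_of_mem_regionD ha ha' r1, e1]
    refine Prod.ext ?_ ?_ <;> simp only <;> ring
  have r2 : (quadMap a)^[2] q ∈ regionC a := by
    rw [Function.iterate_succ_apply']; exact trapped_step_D ha ha' (t 1) r1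
  have e3 : (quadMap a)^[3] q = (1.6 + 0.576 * a - 0.216 * q.1, 1.216 - 0.216 * q.2) := by
    rw [Function.iterate_succ_apply', quadMap_of_mem_regionC ha ha' r2, e2]
    refine Prod.ext ?_ ?_ <;> simp only <;> ring
  have r3 : (quadMap a)^[3] q ∈ regionA := by
    have h3 : (quadMap a)^[3] q ∈ regionA ∨ (quadMap a)^[3] q ∈ regionB a := by
      rw [Function.iterate_succ_apply']; exact trapped_step_C ha ha' (t 2) r2
    refine h3.resolve_right fun h => ?_
    have h1 := h.1
    have h2 := hB.1
    rw [e3] at h1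
    norm_num at h1; linarith
  have e4 : (quadMap a)^[4] q = (-0.96 - 0.3456 * a + 0.1296 * q.1, 0.8704 + 0.1296 * q.2) := by
    rw [Function.iterate_succ_apply', quadMap_of_mem_regionA ha ha' r3, e3]
    refine Prod.ext ?_ ?_ <;> simp only <;> ring
  have r4 : (quadMap a)^[4] q ∈ regionD := by
    rw [Function.iterate_succ_apply']; exact trapped_step_A ha ha' (t 3) r3
  have e5 : (quadMap a)^[5] q =
      (0.576 + 0.20736 * a - 0.07776 * q.1, -0.52224 - 0.07776 * q.2) := by
    rw [Function.iterate_succ_apply', quadMap_of_mem_regionD ha ha' r4, e4]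
    refine Prod.ext ?_ ?_ <;> simp only <;> ring
  have r5 : (quadMap a)^[5] q ∈ regionC a := by
    rw [Function.iterate_succ_apply']; exact trapped_step_D ha ha' (t 4) r4
  have e6 : (quadMap a)^[6] q =
      (1.2544 - 0.124416 * a + 0.046656 * q.1, 0.953344 + 0.046656 * q.2) := by
    rw [Function.iterate_succ_apply', quadMap_of_mem_regionC ha ha' r5, e5]
    refine Prod.ext ?_ ?_ <;> simp only <;> ring
  refine ⟨e1, e2, e3, e4, e5, e6, t 6, ?_⟩
  have h6 : (quadMap a)^[6] q ∈ regionA ∨ (quadMap a)^[6] q ∈ regionB a := by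
    rw [Function.iterate_succ_apply']; exact trapped_step_C ha ha' (t 5) r5
  refine h6.resolve_left fun h => ?_
  have h1 := h.2
  have h2 := hB.1
  rw [e6] at h1
  norm_num at h1; linarith

lemma similarOn_left (ha : 0.4 ≤ a) (ha' : a ≤ 0.5) :
    SimilarOn (quadMap a) 0.6 {q | q ∈ quadSection a ∧ q.1 < 8 / 3 * a} 4 := by
  rintro q ⟨hq, hc⟩ q' ⟨hq', hc'⟩ i hi
  obtain ⟨e1, e2, e3, e4, -⟩ := iterate_four_of_left ha ha' hq hc
  obtain ⟨f1, f2, f3, f4, -⟩ := iterate_four_of_left ha ha' hq' hc'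
  interval_cases i
  · simp
  · rw [e1, f1]
    refine Prod.ext ?_ ?_ <;> simp <;> ring
  · rw [e2, f2]
    refine Prod.ext ?_ ?_ <;> simp <;> ring
  · rw [e3, f3]
    refine Prod.ext ?_ ?_ <;> simp <;> ring
  · rw [e4, f4]
    refine Prod.ext ?_ ?_ <;> simp <;> ring

lemma similarOn_right (ha : 0.4 ≤ a) (ha' : a ≤ 0.5) :
    SimilarOn (quadMap a) 0.6 {q | q ∈ quadSection a ∧ 8 / 3 * a < q.1} 6 := by
  rintro q ⟨hq, hc⟩ q' ⟨hq', hc'⟩ i hi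
  obtain ⟨e1, e2, e3, e4, e5, e6, -⟩ := iterate_six_of_right ha ha' hq hc
  obtain ⟨f1, f2, f3, f4, f5, f6, -⟩ := iterate_six_of_right ha ha' hq' hc'
  interval_cases i
  · simp
  · rw [e1, f1]
    refine Prod.ext ?_ ?_ <;> simp <;> ring
  · rw [e2, f2]
    refine Prod.ext ?_ ?_ <;> simp <;> ring
  · rw [e3, f3]
    refine Prod.ext ?_ ?_ <;> simp <;> ring
  · rw [e4, f4]
    refine Prod.ext ?_ ?_ <;> simp <;> ring
  · rw [e5, f5]
    refine Prod.ext ?_ ?_ <;> simp <;> ring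
  · rw [e6, f6]
    refine Prod.ext ?_ ?_ <;> simp <;> ring

/-- Such a point would be sent to the line x = 0 through the side DA, which the domains of A and D
exclude. -/
lemma quadSection_fst_ne (ha : 0.4 ≤ a) (ha' : a ≤ 0.5) (hq : q ∈ quadSection a) :
    q.1 ≠ 8 / 3 * a := by
  intro h
  have e := quadMap_of_mem_regionB ha ha' hq.2
  rcases trapped_step_B ha ha' hq.1 hq.2 with h' | h'
  all_goals
    have h1 := h'.1
    rw [e, h] at h1
    norm_num at h1
    linarith

/-- The step from C to A requires a height below -0.6. But a point of the domain of A has height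
above 1, hence reaches C, via D, at a height above -0.6, and the next domain is B. -/
lemma exists_iterate_mem_quadSection (ha : 0.4 ≤ a) (ha' : a ≤ 0.5)
    (hq : q ∈ fullyRegular (quadVertices a 0.4) 0.6) :
    ∃ n, (quadMap a)^[n] q ∈ quadSection a := by
  have fromC : ∀ p ∈ trapped a, p ∈ regionC a → p.2 < -0.6 ∨ quadMap a p ∈ quadSection a := by
    intro p hp hC
    rcases trapped_step_C ha ha' hp hC with h | h
    · have h1 := h.2
      rw [quadMap_of_mem_regionC ha ha' hC] at h1
      refine Or.inl ?_
      norm_num at *; linarith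
    · exact Or.inr ⟨mapsTo_trapped ha ha' hp, h⟩
  have fromA : ∀ p ∈ trapped a, p ∈ regionA → ∃ n, (quadMap a)^[n] p ∈ quadSection a := by
    intro p hp hA
    have t := iterate_mem_trapped ha ha' hp
    have r1 : (quadMap a)^[1] p ∈ regionD := trapped_step_A ha ha' hp hA
    have r2 : (quadMap a)^[2] p ∈ regionC a := by
      rw [Function.iterate_succ_apply']; exact trapped_step_D ha ha' (t 1) r1
    rcases fromC _ (t 2) r2 with h | h
    · exfalso
      have h2 := hA.2
      have e1 : (quadMap a)^[1] p = (-0.6 * p.1, 1.6 - 0.6 * p.2) :=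
        quadMap_of_mem_regionA ha ha' hA
      rw [Function.iterate_succ_apply', quadMap_of_mem_regionD ha ha' r1, e1] at h
      norm_num at h; linarith
    · exact ⟨3, by rwa [Function.iterate_succ_apply']⟩
  have fromC' : ∀ p ∈ trapped a, p ∈ regionC a → ∃ n, (quadMap a)^[n] p ∈ quadSection a := by
    intro p hp hC
    have hm := mapsTo_trapped ha ha' hp
    rcases trapped_step_C ha ha' hp hC with h | h
    · obtain ⟨n, hn⟩ := fromA _ hm h
      exact ⟨n + 1, hn⟩
    · exact ⟨1, hm, h⟩
  obtain ⟨m, hm⟩ := exists_iterate_mem_trapped ha ha' hq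
  suffices h : ∃ n, (quadMap a)^[n] ((quadMap a)^[m] q) ∈ quadSection a by
    obtain ⟨n, hn⟩ := h
    exact ⟨n + m, by rwa [Function.iterate_add_apply]⟩
  rcases trapped_region ha hm with h | h | h | h
  · exact fromA _ hm h
  · exact ⟨0, hm, h⟩
  · exact fromC' _ hm h
  · obtain ⟨n, hn⟩ := fromC' _ (mapsTo_trapped ha ha' hm) (trapped_step_D ha ha' hm h)
    exact ⟨n + 1, hn⟩

/-- One return to the section leads into the interval `[1.2544, 1.6]`. -/
lemma exists_return_mem_Icc (ha : 0.4 ≤ a) (ha' : a ≤ 0.5) (hq : q ∈ quadSection a) :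
    ∃ n, (quadMap a)^[n] q ∈ quadSection a ∧ 1.2544 ≤ ((quadMap a)^[n] q).1 ∧
      ((quadMap a)^[n] q).1 ≤ 1.6 := by
  obtain ⟨b1, b2, -, -⟩ := trapped_bounds hq.1
  obtain ⟨h1, h2⟩ := hq.2
  rcases lt_or_gt_of_ne (quadSection_fst_ne ha ha' hq) with hlt | hgt
  · obtain ⟨-, -, -, e, h⟩ := iterate_four_of_left ha ha' hq hlt
    refine ⟨4, h, ?_⟩
    rw [e]
    norm_num at *
    constructor <;> nlinarith
  · obtain ⟨-, -, -, -, -, e, h⟩ := iterate_six_of_right ha ha' hq hgt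
    refine ⟨6, h, ?_⟩
    rw [e]
    norm_num at *
    constructor <;> linarith

lemma isRenormInterval_quadMap (ha : 0.4 ≤ a) (ha' : a ≤ 0.5) (hc : 1.2544 < 8 / 3 * a) :
    IsRenormInterval (quadMap a) (quadSection a) 0.6 (8 / 3 * a) (8 / 3 * a - 1.2544)
      (1.6 - 8 / 3 * a) 4 6 where
  left_pos := by linarith
  right_pos := by norm_num at *; linarith
  time_left_pos := by norm_num
  time_right_pos := by norm_num
  left_return q hq _ hb := by
    obtain ⟨-, -, -, e, h⟩ := iterate_four_of_left ha ha' hq hb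
    refine ⟨h, ?_⟩
    rw [e]; ring
  right_return q hq ha₁ _ := by
    obtain ⟨-, -, -, -, -, e, h⟩ := iterate_six_of_right ha ha' hq ha₁
    refine ⟨h, ?_⟩
    rw [e]; ring
  left_similar := (similarOn_left ha ha').mono fun q hq => ⟨hq.1, hq.2.2⟩
  right_similar := (similarOn_right ha ha').mono fun q hq => ⟨hq.1, hq.2.1⟩
  enter q hq := by
    obtain ⟨n, h1, h2, h3⟩ := exists_return_mem_Icc ha ha' hq
    exact ⟨n, h1, by linarith, by linarith⟩

/-- The orbit approaches the line `y = -0.6` in the region of `C` and the line `y = 1` in the other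
regions. -/
lemma height_bound (ha : 0.4 ≤ a) (ha' : a ≤ 0.5) (hq : q ∈ trapped a) (n : ℕ) :
    ((quadMap a)^[n] q ∈ regionC a ∧ |((quadMap a)^[n] q).2 + 0.6| ≤ 0.6 ^ n * 5) ∨
    (((quadMap a)^[n] q ∈ regionA ∨ (quadMap a)^[n] q ∈ regionB a ∨ (quadMap a)^[n] q ∈ regionD) ∧
      |((quadMap a)^[n] q).2 - 1| ≤ 0.6 ^ n * 5) := by
  induction n with
  | zero =>
    obtain ⟨-, -, b3, b4⟩ := trapped_bounds hq
    have h1 : |q.2 + 0.6| ≤ 5 := by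
      rw [abs_le]; norm_num at *; constructor <;> linarith
    have h2 : |q.2 - 1| ≤ 5 := by
      rw [abs_le]; norm_num at *; constructor <;> linarith
    simp only [Function.iterate_zero, id_eq, pow_zero, one_mul]
    rcases trapped_region ha hq with h | h | h | h
    · exact Or.inr ⟨Or.inl h, h2⟩
    · exact Or.inr ⟨Or.inr (Or.inl h), h2⟩
    · exact Or.inl ⟨h, h1⟩
    · exact Or.inr ⟨Or.inr (Or.inr h), h2⟩
  | succ n ih =>
    have t := iterate_mem_trapped ha ha' hq n
    rw [Function.iterate_succ_apply', pow_succ]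
    generalize (quadMap a)^[n] q = p at *
    generalize (0.6 : ℝ) ^ n = s at *
    rcases ih with ⟨h, hb⟩ | ⟨h | h | h, hb⟩ <;> rw [abs_le] at hb
    · refine Or.inr ⟨(trapped_step_C ha ha' t h).imp id Or.inl, ?_⟩
      rw [quadMap_of_mem_regionC ha ha' h, abs_le]
      norm_num at *; constructor <;> linarith
    · refine Or.inr ⟨Or.inr (Or.inr (trapped_step_A ha ha' t h)), ?_⟩
      rw [quadMap_of_mem_regionA ha ha' h, abs_le]
      norm_num at *; constructor <;> linarith
    · refine Or.inr ⟨(trapped_step_B ha ha' t h).imp id Or.inr, ?_⟩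
      rw [quadMap_of_mem_regionB ha ha' h, abs_le]
      norm_num at *; constructor <;> linarith
    · refine Or.inl ⟨trapped_step_D ha ha' t h, ?_⟩
      rw [quadMap_of_mem_regionD ha ha' h, abs_le]
      norm_num at *; constructor <;> linarith

lemma exists_pow_mul_lt (ε : ℝ) (hε : 0 < ε) : ∃ N, ∀ n ≥ N, (0.6 : ℝ) ^ n * 5 < ε := by
  have := (tendsto_pow_atTop_nhds_zero_of_lt_one (r := (0.6 : ℝ)) (by norm_num)
    (by norm_num)).mul_const 5
  rw [zero_mul] at this
  exact eventually_atTop.1 (this.eventually_lt_const hε)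

lemma height_quadSection (ha : 0.4 ≤ a) (ha' : a ≤ 0.5) :
    ∀ q ∈ quadSection a, ∀ ε > 0, ∃ N, ∀ n ≥ N, (quadMap a)^[n] q ∈ quadSection a →
      |((quadMap a)^[n] q).2 - 1| < ε := by
  intro q hq ε hε
  obtain ⟨N, hN⟩ := exists_pow_mul_lt ε hε
  refine ⟨N, fun n hn hS => ?_⟩
  rcases height_bound ha ha' hq.1 n with h | h
  · exact absurd hS.2.2 (not_lt.2 h.1.2.le)
  · exact h.2.trans_lt (hN n hn)

lemma height_orbitLimit (ha : 0.4 ≤ a) (ha' : a ≤ 0.5) (hq : q ∈ quadSection a) :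
    ∀ z ∈ orbitLimit (quadMap a) q, z.2 ∈ ({1, -0.6} : Set ℝ) := by
  intro z hz
  have key : ∀ ε > 0, |z.2 + 0.6| ≤ ε ∨ |z.2 - 1| ≤ ε := by
    intro ε hε
    obtain ⟨N, hN⟩ := exists_pow_mul_lt ε hε
    have h₁ : IsClosed {p : ℝ × ℝ | |p.2 + 0.6| ≤ ε} := isClosed_le (by fun_prop) continuous_const
    have h₂ : IsClosed {p : ℝ × ℝ | |p.2 - 1| ≤ ε} := isClosed_le (by fun_prop) continuous_const
    refine orbitLimit_subset_of_eventually_mem (h₁.union h₂) N (fun n hn => ?_) hz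
    exact (height_bound ha ha' hq.1 n).imp (fun h => h.2.trans (hN n hn).le)
      (fun h => h.2.trans (hN n hn).le)
  by_contra hcon
  simp only [mem_insert_iff, mem_singleton_iff, not_or] at hcon
  have p1 : 0 < |z.2 - 1| := abs_pos.2 (sub_ne_zero.2 hcon.1)
  have p2 : 0 < |z.2 + 0.6| := abs_pos.2 fun h => hcon.2 (by linarith)
  have hm := lt_min p1 p2
  rcases key (min |z.2 - 1| |z.2 + 0.6| / 2) (by positivity) with h | h
  · have := min_le_right |z.2 - 1| |z.2 + 0.6|
    linarith
  · have := min_le_left |z.2 - 1| |z.2 + 0.6|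
    linarith

end trapping

/-! ### Existence of fully regular points in the rectangles. -/

/-- The return map to the section in the first coordinate, with discontinuity `c`. -/
noncomputable def returnMap (c x : ℝ) : ℝ :=
  if x < c then 1.6 + 0.1296 * (x - c) else 1.2544 + 0.046656 * (x - c)

/-- Both affine branches are injective, so each iterated preimage of `c` is countable. -/
lemma countable_hitting (c : ℝ) : {x : ℝ | ∃ n, (returnMap c)^[n] x = c}.Countable := by
  have hn : ∀ n, {x : ℝ | (returnMap c)^[n] x = c}.Countable := by
    intro n
    induction n with
    | zero => simp
    | succ n ih =>
      have h1 : Function.Injective fun x : ℝ => 1.6 + 0.1296 * (x - c) := fun x y h => by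
        simp only at h; linarith
      have h2 : Function.Injective fun x : ℝ => 1.2544 + 0.046656 * (x - c) := fun x y h => by
        simp only at h; linarith
      refine ((ih.preimage h1).union (ih.preimage h2)).mono fun x hx => ?_
      have hx' : (returnMap c)^[n] (returnMap c x) = c := hx
      unfold returnMap at hx'
      by_cases hlt : x < c
      · rw [if_pos hlt] at hx'; exact Or.inl hx'
      · rw [if_neg hlt] at hx'; exact Or.inr hx'
  have e : {x : ℝ | ∃ n, (returnMap c)^[n] x = c} = ⋃ n, {x : ℝ | (returnMap c)^[n] x = c} := by
    ext x
    rw [mem_iUnion]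
    rfl
  rw [e]
  exact countable_iUnion hn

section existence

variable {a : ℝ} {q : ℝ × ℝ}

lemma mem_regionB_of_mem_strip (ha' : a ≤ 0.5) (hq : q ∈ Icc (1.2 : ℝ) 1.6 ×ˢ Ioo (0.9 : ℝ) 1) :
    q ∈ regionB a := by
  obtain ⟨⟨h1, h2⟩, h3, h4⟩ := hq
  norm_num at *
  constructor
  · exact h4
  · norm_num; nlinarith

/-- A point of a thin strip in the region of `B` returns to the strip through regular points. -/
lemma strip_return (ha : 0.4 ≤ a) (ha' : a ≤ 0.5)
    (hq : q ∈ Icc (1.2 : ℝ) 1.6 ×ˢ Ioo (0.9 : ℝ) 1) (hc : q.1 ≠ 8 / 3 * a) :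
    ∃ m > 0, (∀ i < m, (quadMap a)^[i] q ∈ regularPoints (quadVertices a 0.4)) ∧
      (quadMap a)^[m] q ∈ Icc (1.2 : ℝ) 1.6 ×ˢ Ioo (0.9 : ℝ) 1 ∧
      ((quadMap a)^[m] q).1 = returnMap (8 / 3 * a) q.1 := by
  have hB := mem_regionB_of_mem_strip ha' hq
  obtain ⟨⟨h1, h2⟩, h3, h4⟩ := hq
  have e1 : (quadMap a)^[1] q = (1.6 * a - 0.6 * q.1, 1.6 - 0.6 * q.2) :=
    quadMap_of_mem_regionB ha ha' hB
  -- Regularity is not assumed here, so each domain on the itinerary is verified from the explicit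
  -- coordinates.
  rcases lt_or_gt_of_ne hc with hlt | hgt
  · have r1 : (quadMap a)^[1] q ∈ regionA := by
      rw [e1]; norm_num at *
      constructor <;> norm_num <;> linarith
    have e2 : (quadMap a)^[2] q = (-0.96 * a + 0.36 * q.1, 0.64 + 0.36 * q.2) := by
      rw [Function.iterate_succ_apply', quadMap_of_mem_regionA ha ha' r1, e1]
      refine Prod.ext ?_ ?_ <;> simp only <;> ring
    have r2 : (quadMap a)^[2] q ∈ regionD := by
      rw [e2]; norm_num at *
      constructor <;> norm_num <;> linarith
    have e3 : (quadMap a)^[3] q = (0.576 * a - 0.216 * q.1, -0.384 - 0.216 * q.2) := by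
      rw [Function.iterate_succ_apply', quadMap_of_mem_regionD ha ha' r2, e2]
      refine Prod.ext ?_ ?_ <;> simp only <;> ring
    have r3 : (quadMap a)^[3] q ∈ regionC a := by
      rw [e3]; norm_num at *
      constructor <;> norm_num <;> nlinarith
    have e4 : (quadMap a)^[4] q = (1.6 - 0.3456 * a + 0.1296 * q.1, 0.8704 + 0.1296 * q.2) := by
      rw [Function.iterate_succ_apply', quadMap_of_mem_regionC ha ha' r3, e3]
      refine Prod.ext ?_ ?_ <;> simp only <;> ring
    refine ⟨4, by norm_num, fun i hi => ?_, ?_, ?_⟩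
    · interval_cases i
      · exact regular_of_mem_regionB ha ha' hB
      · exact regular_of_mem_regionA ha r1
      · exact regular_of_mem_regionD ha ha' r2
      · exact regular_of_mem_regionC ha ha' r3
    · rw [e4]; norm_num at *
      refine ⟨⟨?_, ?_⟩, ?_, ?_⟩ <;> linarith
    · rw [e4, returnMap, if_pos hlt]
      simp only; ring
  · have r1 : (quadMap a)^[1] q ∈ regionD := by
      rw [e1]; norm_num at *
      constructor <;> norm_num <;> linarith
    have e2 : (quadMap a)^[2] q = (-0.96 * a + 0.36 * q.1, -0.96 + 0.36 * q.2) := by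
      rw [Function.iterate_succ_apply', quadMap_of_mem_regionD ha ha' r1, e1]
      refine Prod.ext ?_ ?_ <;> simp only <;> ring
    have r2 : (quadMap a)^[2] q ∈ regionC a := by
      rw [e2]; norm_num at *
      constructor <;> norm_num <;> nlinarith
    have e3 : (quadMap a)^[3] q = (1.6 + 0.576 * a - 0.216 * q.1, 1.216 - 0.216 * q.2) := by
      rw [Function.iterate_succ_apply', quadMap_of_mem_regionC ha ha' r2, e2]
      refine Prod.ext ?_ ?_ <;> simp only <;> ring
    have r3 : (quadMap a)^[3] q ∈ regionA := by
      rw [e3]; norm_num at *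
      constructor <;> norm_num <;> linarith
    have e4 : (quadMap a)^[4] q = (-0.96 - 0.3456 * a + 0.1296 * q.1, 0.8704 + 0.1296 * q.2) := by
      rw [Function.iterate_succ_apply', quadMap_of_mem_regionA ha ha' r3, e3]
      refine Prod.ext ?_ ?_ <;> simp only <;> ring
    have r4 : (quadMap a)^[4] q ∈ regionD := by
      rw [e4]; norm_num at *
      constructor <;> norm_num <;> linarith
    have e5 : (quadMap a)^[5] q =
        (0.576 + 0.20736 * a - 0.07776 * q.1, -0.52224 - 0.07776 * q.2) := by
      rw [Function.iterate_succ_apply', quadMap_of_mem_regionD ha ha' r4, e4]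
      refine Prod.ext ?_ ?_ <;> simp only <;> ring
    have r5 : (quadMap a)^[5] q ∈ regionC a := by
      rw [e5]; norm_num at *
      constructor <;> norm_num <;> nlinarith
    have e6 : (quadMap a)^[6] q =
        (1.2544 - 0.124416 * a + 0.046656 * q.1, 0.953344 + 0.046656 * q.2) := by
      rw [Function.iterate_succ_apply', quadMap_of_mem_regionC ha ha' r5, e5]
      refine Prod.ext ?_ ?_ <;> simp only <;> ring
    refine ⟨6, by norm_num, fun i hi => ?_, ?_, ?_⟩
    · interval_cases i
      · exact regular_of_mem_regionB ha ha' hB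
      · exact regular_of_mem_regionD ha ha' r1
      · exact regular_of_mem_regionC ha ha' r2
      · exact regular_of_mem_regionA ha r3
      · exact regular_of_mem_regionD ha ha' r4
      · exact regular_of_mem_regionC ha ha' r5
    · rw [e6]; norm_num at *
      refine ⟨⟨?_, ?_⟩, ?_, ?_⟩ <;> linarith
    · rw [e6, returnMap, if_neg (not_lt.2 hgt.le)]
      simp only; ring

lemma fullyRegular_of_strip (ha : 0.4 ≤ a) (ha' : a ≤ 0.5)
    (hq : q ∈ Icc (1.2 : ℝ) 1.6 ×ˢ Ioo (0.9 : ℝ) 1)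
    (hc : ∀ n, (returnMap (8 / 3 * a))^[n] q.1 ≠ 8 / 3 * a) :
    q ∈ fullyRegular (quadVertices a 0.4) 0.6 := by
  intro n
  induction n using Nat.strong_induction_on generalizing q with
  | _ n ih =>
    obtain ⟨m, hm, hreg, hS, e⟩ := strip_return ha ha' hq (hc 0)
    by_cases hn : n < m
    · exact hreg n hn
    · have := ih (n - m) (by omega) hS fun j => by rw [e]; exact hc (j + 1)
      rwa [← Function.iterate_add_apply, Nat.sub_add_cancel (not_lt.1 hn)] at this

lemma nonempty_fullyRegular_inter_rect (ha : 0.4 ≤ a) (ha' : a ≤ 0.5) {ε : ℝ} (hε : 0 < ε)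
    (hε' : ε < 0.1) :
    (fullyRegular (quadVertices a 0.4) 0.6 ∩ (rectUpper a 0.6 ε ∪ rectLower a 0.6 ε)).Nonempty := by
  have hcount : {t : ℝ | 1.6 - 0.36 * t ∈ {x : ℝ | ∃ n, (returnMap (8 / 3 * a))^[n] x = 8 / 3 * a}}.Countable :=
    (countable_hitting (8 / 3 * a)).preimage (f := fun t : ℝ => 1.6 - 0.36 * t) fun x y h => by
      simp only at h; linarith
  -- The point `(-t, 1 - ε ^ 2)` reaches the strip in two steps, through D and C, with first
  -- coordinate `1.6 - 0.36 * t`; `t` is chosen so that this coordinate never hits the jump.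
  obtain ⟨t, ht, ht0, ht1⟩ := (hcount.dense_compl ℝ).exists_mem_open isOpen_Ioo
    (nonempty_Ioo.2 (zero_lt_one (α := ℝ)))
  have hsq : ε ^ 2 < 0.01 := by norm_num at *; nlinarith
  have hsq0 : 0 < ε ^ 2 := by positivity
  obtain ⟨p, hp⟩ : ∃ p : ℝ × ℝ, p = (-t, 1 - ε ^ 2) := ⟨_, rfl⟩
  have r0 : p ∈ regionD := by
    rw [hp]; norm_num at *
    constructor <;> norm_num <;> linarith
  have e1 : (quadMap a)^[1] p = (0.6 * t, -0.6 * (1 - ε ^ 2)) := by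
    rw [Function.iterate_one, quadMap_of_mem_regionD ha ha' r0, hp]
    refine Prod.ext ?_ ?_ <;> simp only <;> ring
  have r1 : (quadMap a)^[1] p ∈ regionC a := by
    rw [e1]; norm_num at *
    constructor <;> norm_num <;> nlinarith
  have e2 : (quadMap a)^[2] p = (1.6 - 0.36 * t, 1 - 0.36 * ε ^ 2) := by
    rw [Function.iterate_succ_apply', quadMap_of_mem_regionC ha ha' r1, e1]
    refine Prod.ext ?_ ?_ <;> simp only <;> ring
  have h2 : (quadMap a)^[2] p ∈ fullyRegular (quadVertices a 0.4) 0.6 := by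
    refine fullyRegular_of_strip ha ha' ?_ ?_
    · rw [e2]; norm_num at *
      refine ⟨⟨?_, ?_⟩, ?_, ?_⟩ <;> linarith
    · rw [e2]
      intro n hn
      exact ht ⟨n, hn⟩
  refine ⟨p, fun n => ?_, Or.inr ?_⟩
  · match n with
    | 0 => exact regular_of_mem_regionD ha ha' r0
    | 1 => exact regular_of_mem_regionC ha ha' r1
    | n + 2 =>
      have := h2 n
      rwa [← Function.iterate_add_apply] at this
  · rw [hp]
    refine ⟨⟨?_, by simp only; linarith⟩, by simp only; linarith, by simp only; linarith⟩
    simp only [segLength]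
    norm_num at *
    linarith

lemma quadSection_nonempty (ha : 0.4 ≤ a) (ha' : a ≤ 0.5) : (quadSection a).Nonempty := by
  obtain ⟨x, hx, -⟩ := nonempty_fullyRegular_inter_rect ha ha' (ε := 0.05) (by norm_num)
    (by norm_num)
  obtain ⟨n, hn⟩ := exists_iterate_mem_quadSection ha ha' hx
  exact ⟨_, hn⟩

end existence

/-! ### The attractor and the Cantor parameters. -/

section main

variable {a : ℝ}

/-- An attractor of a part of the section that is visited by all orbits attracts all of `X`. -/
lemma isAsymptoticTo_of_visited {S : Set (ℝ × ℝ)} {K : Set (ℝ × ℝ)}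
    (hS : ∀ x ∈ fullyRegular (quadVertices a 0.4) 0.6, ∃ n, (quadMap a)^[n] x ∈ S)
    (hK : ∀ q ∈ S, IsAsymptoticTo (quadVertices a 0.4) 0.6 q K) :
    ∀ x ∈ fullyRegular (quadVertices a 0.4) 0.6,
      IsAsymptoticTo (quadVertices a 0.4) 0.6 x K := by
  intro x hx
  obtain ⟨n, hn⟩ := hS x hx
  obtain ⟨h1, h2⟩ := hK _ hn
  refine ⟨?_, ?_⟩
  · rw [← tendsto_add_atTop_iff_nat n]
    refine h1.congr fun m => ?_
    rw [← Function.iterate_add_apply]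
  -- `omegaSet` and `orbitLimit` agree by definition for `quadMap a`.
  · have h2' : orbitLimit (quadMap a) ((quadMap a)^[n] x) = K := h2
    rw [orbitLimit_iterate] at h2'
    exact h2'

lemma isRectAttractor_of_forall (ha : 0.4 ≤ a) (ha' : a ≤ 0.5) {K : Set (ℝ × ℝ)}
    (hK : IsPeriodicOrbit (quadVertices a 0.4) 0.6 K ∨ IsCantorSet K)
    (h : ∀ x ∈ fullyRegular (quadVertices a 0.4) 0.6,
      IsAsymptoticTo (quadVertices a 0.4) 0.6 x K) : IsRectAttractor a 0.4 0.6 K :=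
  ⟨hK, 0.1, by norm_num, fun _ hε hε' =>
    ⟨nonempty_fullyRegular_inter_rect ha ha' hε hε', fun x hx => h x hx.1⟩⟩

lemma exists_periodic_attractor (ha : 0.4 ≤ a) (ha' : a ≤ 0.5) {S : Set (ℝ × ℝ)} {N : ℕ}
    (hN : 0 < N) (hSX : S ⊆ quadSection a)
    (hS : ∀ q ∈ quadSection a, ∃ n, (quadMap a)^[n] q ∈ S)
    (hsim : SimilarOn (quadMap a) 0.6 S N) (hm : ∀ q ∈ S, (quadMap a)^[N] q ∈ S) :
    ∃ K, IsPeriodicOrbit (quadVertices a 0.4) 0.6 K ∧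
      ∀ x ∈ fullyRegular (quadVertices a 0.4) 0.6,
        IsAsymptoticTo (quadVertices a 0.4) 0.6 x K := by
  obtain ⟨q₀, hq₀⟩ := quadSection_nonempty ha ha'
  obtain ⟨n₀, hn₀⟩ := hS q₀ hq₀
  obtain ⟨w, hw, hlim⟩ := exists_periodic_limit (by norm_num) (by norm_num) hN ⟨_, hn₀⟩ hsim hm
  refine ⟨range w, ⟨N, w, hN, hw, rfl, fun i => ?_⟩, isAsymptoticTo_of_visited (S := S) ?_ ?_⟩
  · have hl := hlim _ hn₀
    have hX := (hSX hn₀).1.1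
    generalize (quadMap a)^[n₀] q₀ = p at *
    have hper : ∀ i j, w (i + j * N) = w i := by
      intro i j
      induction j with
      | zero => simp
      | succ j ih => rw [Nat.succ_mul, ← add_assoc, hw, ih]
    -- The points `w i` may be singular. Consecutive points of a regular orbit that converges to
    -- `w`, taken at late times congruent to `i`, give points of the graph near `(w i, w (i + 1))`.
    rw [Metric.mem_closure_iff]
    intro ε hε
    obtain ⟨M, hM⟩ := Metric.tendsto_atTop.1 hl ε hε
    have hle : M ≤ M * N := Nat.le_mul_of_pos_right _ hN
    have h1 := hM (i + M * N) (by omega)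
    have h2 := hM (i + 1 + M * N) (by omega)
    rw [Real.dist_eq, sub_zero, abs_of_nonneg dist_nonneg, hper, dist_comm] at h1 h2
    refine ⟨((quadMap a)^[i + M * N] p, (quadMap a)^[i + 1 + M * N] p), ⟨hX _, ?_⟩, ?_⟩
    · have e : i + 1 + M * N = (i + M * N) + 1 := by omega
      simp only [e, Function.iterate_succ_apply']
    · rw [Prod.dist_eq]
      exact max_lt h1 h2
  · intro x hx
    obtain ⟨n, hn⟩ := exists_iterate_mem_quadSection ha ha' hx
    obtain ⟨m, hm'⟩ := hS _ hn
    exact ⟨m + n, by rwa [Function.iterate_add_apply]⟩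
  · intro q hq
    exact ⟨tendsto_infDist_range (hlim q hq), orbitLimit_eq_range hN hw (hlim q hq)⟩

lemma exists_cantor_attractor (ha : 0.4 ≤ a) (ha' : a ≤ 0.5) {d₁ d₂ : ℕ → ℝ} {k l : ℕ → ℕ}
    (h : ∀ n, IsRenormInterval (quadMap a) (quadSection a) 0.6 (8 / 3 * a) (d₁ n) (d₂ n) (k n) (l n))
    (hd : ∀ δ > 0, ∃ n, d₁ n < δ ∧ d₂ n < δ) :
    ∃ K, IsCantorSet K ∧ ∀ x ∈ fullyRegular (quadVertices a 0.4) 0.6,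
      IsAsymptoticTo (quadVertices a 0.4) 0.6 x K := by
  have h0 : (0 : ℝ) < 0.6 := by norm_num
  have h1 : (0.6 : ℝ) < 1 := by norm_num
  obtain ⟨q₀, hq₀⟩ := quadSection_nonempty ha ha'
  have hB : ∀ δ > 0, HasBlocks (quadMap a) (quadSection a) 0.6 δ := fun δ hδ =>
    IsRenormInterval.hasBlocks h0 h1 (fun q hq => quadSection_fst_ne ha ha' hq) h hd hδ
  have hy := height_quadSection ha ha'
  have hbox : ∀ q ∈ quadSection a, ∀ n, (quadMap a)^[n] q ∈ trappingBox := fun q hq n =>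
    (iterate_mem_trapped ha ha' hq.1 n).2
  refine ⟨orbitLimit (quadMap a) q₀, isCantorSet_orbitLimit h0 h1 hy hB hq₀ isCompact_trappingBox
    (hbox q₀ hq₀) (Set.toFinite {1, -0.6}).countable (height_orbitLimit ha ha' hq₀),
    isAsymptoticTo_of_visited (fun x hx => exists_iterate_mem_quadSection ha ha' hx)
      fun q hq => ?_⟩
  have e : orbitLimit (quadMap a) q = orbitLimit (quadMap a) q₀ :=
    (orbitLimit_subset_of_hasBlocks h0 h1 hy hB hq hq₀).antisymm
      (orbitLimit_subset_of_hasBlocks h0 h1 hy hB hq₀ hq)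
  rw [← e]
  exact ⟨tendsto_infDist_orbitLimit isCompact_trappingBox (hbox q hq), rfl⟩

theorem exists_attractor (ha : 0.4 ≤ a) (ha' : a ≤ 0.5) :
    ∃ K, (IsPeriodicOrbit (quadVertices a 0.4) 0.6 K ∨ IsCantorSet K) ∧
      ∀ x ∈ fullyRegular (quadVertices a 0.4) 0.6,
        IsAsymptoticTo (quadVertices a 0.4) 0.6 x K := by
  have h0 : (0 : ℝ) < 0.6 := by norm_num
  have h1 : (0.6 : ℝ) < 1 := by norm_num
  have hne : ∀ q ∈ quadSection a, q.1 ≠ 8 / 3 * a := fun q hq => quadSection_fst_ne ha ha' hq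
  rcases le_or_gt (8 / 3 * a) 1.2544 with hc | hc
  -- The right branch takes values above 1.2544 ≥ `8 / 3 * a`, so the part to the right of the jump
  -- is invariant, and every orbit enters it because it visits `[1.2544, 1.6]`.
  · have hret : ∀ q ∈ quadSection a, 8 / 3 * a < q.1 → (quadMap a)^[6] q ∈ quadSection a ∧
        8 / 3 * a < ((quadMap a)^[6] q).1 := by
      intro q hq hlt
      obtain ⟨-, -, -, -, -, e, h⟩ := iterate_six_of_right ha ha' hq hlt
      refine ⟨h, lt_of_le_of_ne ?_ (hne _ h).symm⟩
      rw [e]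
      norm_num at *; linarith
    have hvis : ∀ q ∈ quadSection a,
        ∃ n, (quadMap a)^[n] q ∈ {q | q ∈ quadSection a ∧ 8 / 3 * a < q.1} := by
      intro q hq
      obtain ⟨n, hn, h2, -⟩ := exists_return_mem_Icc ha ha' hq
      exact ⟨n, hn, lt_of_le_of_ne (hc.trans h2) (hne _ hn).symm⟩
    obtain ⟨K, hK, hKX⟩ := exists_periodic_attractor ha ha' (by norm_num) (fun q hq => hq.1)
      hvis (similarOn_right ha ha') (fun q hq => hret q hq.1 hq.2)
    exact ⟨K, Or.inl hK, hKX⟩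
  · rcases (isRenormInterval_quadMap ha ha' hc).terminal_or_infinite h0 h1 with
      ⟨d₁, d₂, k, l, h, hl, hk⟩ | ⟨d₁, d₂, k, l, h, hd⟩
    · obtain ⟨hm, hsim⟩ := h.left_mapsTo_of_terminal hne h0 hl hk
      have hvis : ∀ q ∈ quadSection a, ∃ n, (quadMap a)^[n] q ∈
          {q | q ∈ quadSection a ∧ 8 / 3 * a - d₁ ≤ q.1 ∧ q.1 < 8 / 3 * a} := by
        intro q hq
        obtain ⟨n, -, hn⟩ := h.visit_left hne h0 h1 hq 0
        exact ⟨n, hn⟩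
      obtain ⟨K, hK, hKX⟩ := exists_periodic_attractor ha ha'
        (Nat.add_pos_left h.time_right_pos k) (fun q hq => hq.1) hvis hsim hm
      exact ⟨K, Or.inl hK, hKX⟩
    · obtain ⟨K, hK, hKX⟩ := exists_cantor_attractor ha ha' h hd
      exact ⟨K, Or.inr hK, hKX⟩

theorem exists_parameter_cantor_attractor :
    ∃ a : ℝ, 0.4 ≤ a ∧ a ≤ 0.5 ∧ ∃ K, IsCantorSet K ∧
      ∀ x ∈ fullyRegular (quadVertices a 0.4) 0.6,
        IsAsymptoticTo (quadVertices a 0.4) 0.6 x K := by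
  have h0 : (0 : ℝ) < 0.6 := by norm_num
  have h1 : (0.6 : ℝ) < 1 := by norm_num
  obtain ⟨c, d₁, d₂, k, l, e₁, e₂, ek, el, hd⟩ :=
    exists_alternating (lam := 0.6) (p := 1.2544) (r := 1.6) h0 (by norm_num) 4 6
  obtain ⟨p₁, p₂, p₃, -⟩ := hd 0
  rw [e₁] at p₁
  rw [e₁, e₂, el] at p₃
  have ha : (0.4 : ℝ) ≤ 3 / 8 * c := by norm_num at *; linarith
  -- The first inequality, `d₁ 0 < 0.6 ^ 6 * d₂ 0`, keeps `c` close to 1.2544 and hence below 4/3.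
  have ha' : 3 / 8 * c ≤ (0.5 : ℝ) := by norm_num at *; linarith
  have ec : 8 / 3 * (3 / 8 * c) = c := by ring
  have h : IsRenormInterval (quadMap (3 / 8 * c)) (quadSection (3 / 8 * c)) 0.6 c
      (d₁ 0) (d₂ 0) (k 0) (l 0) := by
    have := isRenormInterval_quadMap ha ha' (by rw [ec]; linarith)
    rw [ec] at this
    rwa [e₁, e₂, ek, el]
  obtain ⟨hR, hδ⟩ := h.infinite_of_alternating h0 h1 hd
  exact ⟨3 / 8 * c, ha, ha', exists_cantor_attractor ha ha' (by rw [ec]; exact hR) hδ⟩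

end main

theorem mainTheorem4 :
    (∀ a : ℝ, 0.4 ≤ a → a ≤ 0.5 →
      ∃ K : Set (ℝ × ℝ), IsRectAttractor a 0.4 0.6 K ∧
        ∀ x ∈ fullyRegular (quadVertices a 0.4) 0.6,
          IsAsymptoticTo (quadVertices a 0.4) 0.6 x K) ∧
    (∃ a : ℝ, 0.4 ≤ a ∧ a ≤ 0.5 ∧
      ∃ K : Set (ℝ × ℝ), IsCantorSet K ∧ IsRectAttractor a 0.4 0.6 K ∧
        ∀ x ∈ fullyRegular (quadVertices a 0.4) 0.6,
          IsAsymptoticTo (quadVertices a 0.4) 0.6 x K) := by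
  refine ⟨fun a ha ha' => ?_, ?_⟩
  · obtain ⟨K, hK, h⟩ := exists_attractor ha ha'
    exact ⟨K, isRectAttractor_of_forall ha ha' hK h, h⟩
  · obtain ⟨a, ha, ha', K, hK, h⟩ := exists_parameter_cantor_attractor
    exact ⟨a, ha, ha', K, hK, isRectAttractor_of_forall ha ha' (Or.inr hK) h, h⟩
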